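/- Let $k$ be a commutative artinian ring, let $n\ge 1$, and let $(\mathscr C,\mathbb E,\mathfrak s)$ be a $k$-linear $n$-exangulated category (in the sense of Herschend–Liu–Nakaoka; $k$-linear means that all $\mathscr C(A,B)$ and $\mathbb E(A,B)$ are $k$-modules and that composition and the actions of $\mathscr C$ on $\mathbb E$ are $k$-multilinear). Assume that $\mathscr C$ is $\mathrm{Ext}$-finite, i.e. every $\mathbb E(A,B)$ is a finitely generated $k$-module, and Krull–Schmidt, i.e. every object is a finite direct sum of objects with local endomorphism rings. Let $D=\mathrm{Hom}_k(-,E)$, where $E$ is the minimal injective cogenerator of $k$ (the injective envelope of $k/\mathrm{rad}\,k$). A morphism $f\colon X\to Y$ is *right $C$-determined* if every $g\colon L\to Y$, such that $g\circ h$ factors through $f$ for all $h\colon C\to L$, factors through $f$. An object $Y$ is *right deflation-classified* if (a) each deflation $\alpha\colon X\to Y$ is right $C$-determined for some object $C$, and (b) for each object $C$ and each $\mathrm{End}_{\mathscr C}(C)^{\mathrm{op}}$-submodule $H$ of $\mathscr C(C,Y)$ there is a deflation $\alpha\colon X\to Y$ which is right $C$-determined and satisfies $\mathrm{Im}\,\mathscr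 C(C,\alpha)=H$. The category $\mathscr C$ *has right determined deflations* if every object is right deflation-classified. Dually, $f\colon X\to Y$ is *left $C$-determined* if every $g\colon X\to L$, such that $h\circ g$ factors through $f$ for all $h\colon L\to C$, factors through $f$; an object $X$ is *left inflation-classified* if (a) each inflation $\alpha\colon X\to Y$ is left $C$-determined for some object $C$, and (b) for each object $C$ and each $\mathrm{End}_{\mathscr C}(C)$-submodule $H$ of $\mathscr C(X,C)$ there is an inflation $\alpha\colon X\to Y$ which is left $C$-determined and satisfies $\mathrm{Im}\,\mathscr C(\alpha,C)=H$; and $\mathscr C$ *has left determined inflations* if every object is left inflation-classified. The category $\mathscr C$ *has Serre duality* if there is a $k$-linear auto-equivalence $\tau_n\colon\mathscr C\to\mathscr C$ together with $k$-linear isomorphisms $D\mathbb E(X,Y)\cong\mathscr C(Y,\tau_n X)$, natural in $X,Y\in\mathscr C$. **Theorem.** $\mathscr C$ has Serre duality if and only if $\mathscr C$ has right determined deflations and left determined inflations. -/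

import Mathlib

open CategoryTheory CategoryTheory.Limits Opposite

universe w w' v u

noncomputable section

/-! ### The duality on modules over a commutative artinian ring -/

/-- `ι : M → I` is an injective envelope of `M`: the module `I` is injective, `ι` is injective, and
`I` is an essential extension of the image of `ι`, i.e. every nonzero element of `I` has a nonzero
multiple in the image (equivalently, every nonzero submodule of `I` meets the image). -/
structure IsInjectiveEnvelope {R : Type w} [CommRing R] {M I : Type w} [AddCommGroup M]
    [Module R M] [AddCommGroup I] [Module R I] (ι : M →ₗ[R] I) : Prop where
  injective : Module.Injective R I
  mono : Function.Injective ι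
  essential : ∀ x : I, x ≠ 0 → ∃ r : R, r • x ≠ 0 ∧ r • x ∈ LinearMap.range ι

/-- Injective envelopes exist. -/
theorem exists_injectiveEnvelope (R : Type w) [CommRing R] (M : Type w) [AddCommGroup M]
    [Module R M] :
    ∃ (I : ModuleCat.{w} R) (ι : M →ₗ[R] I), IsInjectiveEnvelope ι := by
  have : EnoughInjectives (ModuleCat.{w} R) := ModuleCat.enoughInjectives.{w, w} R
  let J : ModuleCat.{w} R := Injective.under (ModuleCat.of R M)
  let j : M →ₗ[R] J := (Injective.ι (ModuleCat.of R M)).hom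
  have hj : Function.Injective j := (ModuleCat.mono_iff_injective _).1 inferInstance
  have hJ : Module.Injective R J := (Module.injective_iff_injective_object R J).2
    (inferInstanceAs (Injective (Injective.under (ModuleCat.of R M))))
  let P : Set (Submodule R J) := {N | LinearMap.range j ≤ N ∧
    ∀ x ∈ N, x ≠ 0 → ∃ r : R, r • x ≠ 0 ∧ r • x ∈ LinearMap.range j}
  obtain ⟨N, -, hN⟩ : ∃ N, LinearMap.range j ≤ N ∧ Maximal (· ∈ P) N := by
    refine zorn_le_nonempty₀ P (fun c hc hch y hy => ⟨sSup c, ⟨?_, ?_⟩, fun z hz => le_sSup hz⟩)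
      _ ⟨le_rfl, fun x hx h0 => ⟨1, by simpa using h0, by simpa using hx⟩⟩
    · exact (hc hy).1.trans (le_sSup hy)
    · intro x hx h0
      obtain ⟨L, hL, hxL⟩ := (Submodule.mem_sSup_of_directed ⟨y, hy⟩ hch.directedOn).1 hx
      exact (hc hL).2 x hxL h0
  obtain ⟨N', -, hN'⟩ : ∃ N', ⊥ ≤ N' ∧ Maximal (· ∈ {L | Disjoint N L}) N' := by
    refine zorn_le_nonempty₀ {L | Disjoint N L}
      (fun c hc hch y hy => ⟨sSup c, ?_, fun z hz => le_sSup hz⟩) _ disjoint_bot_right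
    refine Submodule.disjoint_def.2 fun x hxN hx => ?_
    obtain ⟨L, hL, hxL⟩ := (Submodule.mem_sSup_of_directed ⟨y, hy⟩ hch.directedOn).1 hx
    exact Submodule.disjoint_def.1 (hc hL) x hxN hxL
  have hdis : Disjoint N N' := hN'.prop
  let f : N →ₗ[R] (J ⧸ N') := N'.mkQ.comp N.subtype
  have hf : Function.Injective f := by
    refine (injective_iff_map_eq_zero f).2 fun x hx => ?_
    have : (x : J) ∈ N' := by simpa [f] using hx
    exact Subtype.ext (Submodule.disjoint_def.1 hdis x x.2 this)
  obtain ⟨g, hg⟩ := hJ.out f hf N.subtype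
  have hgq : ∀ x ∈ N, g (N'.mkQ x) = x := fun x hx => hg ⟨x, hx⟩
  -- every element of the quotient outside zero has a multiple in the image of `N`
  have hess : ∀ y : J, y ∉ N' → ∃ r : R, ∃ n ∈ N, n ≠ 0 ∧ r • y - n ∈ N' := by
    intro y hy
    by_contra hcon
    push Not at hcon
    have hd : Disjoint N (N' ⊔ Submodule.span R {y}) := by
      refine Submodule.disjoint_def.2 fun x hxN hx => ?_
      obtain ⟨a, ha, b, hb, rfl⟩ := Submodule.mem_sup.1 hx
      obtain ⟨r, rfl⟩ := Submodule.mem_span_singleton.1 hb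
      by_contra hne
      refine hcon r _ hxN hne ?_
      have : r • y - (a + r • y) = -a := by abel
      rw [this]
      exact N'.neg_mem ha
    have hle := hN'.le_of_ge hd le_sup_left
    exact hy (hle (Submodule.mem_sup_right (Submodule.mem_span_singleton_self y)))
  have hmulg : ∀ y : J, y ∉ N' → ∃ r : R, ∃ n ∈ N, n ≠ 0 ∧ r • g (N'.mkQ y) = n := by
    intro y hy
    obtain ⟨r, n, hn, hn0, h⟩ := hess y hy
    refine ⟨r, n, hn, hn0, ?_⟩
    have : N'.mkQ (r • y) = N'.mkQ n := by
      simpa [Submodule.Quotient.eq] using (Submodule.Quotient.eq N').2 h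
    rw [← hgq n hn, ← this, map_smul, map_smul]
  have hker : ∀ y : J, g (N'.mkQ y) = 0 → y ∈ N' := by
    intro y h0
    by_contra hy
    obtain ⟨r, n, -, hn0, h⟩ := hmulg y hy
    rw [h0, smul_zero] at h
    exact hn0 h.symm
  have hrange : LinearMap.range g ∈ P := by
    refine ⟨fun x hx => ⟨N'.mkQ x, hgq x (hN.prop.1 hx)⟩, ?_⟩
    rintro _ ⟨z, rfl⟩ h0
    obtain ⟨y, rfl⟩ := N'.mkQ_surjective z
    have hy : y ∉ N' := by
      intro hy
      apply h0
      have : N'.mkQ y = 0 := by simpa using hy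
      rw [this, map_zero]
    obtain ⟨r, n, hn, hn0, h⟩ := hmulg y hy
    obtain ⟨s, hs0, hs⟩ := hN.prop.2 n hn hn0
    exact ⟨s * r, by rw [mul_smul, h]; exact hs0, by rw [mul_smul, h]; exact hs⟩
  have hsub : LinearMap.range g ≤ N :=
    hN.le_of_ge hrange fun x hx => ⟨N'.mkQ x, hgq x hx⟩
  let p : J →ₗ[R] N := (g.comp N'.mkQ).codRestrict N fun x => hsub ⟨N'.mkQ x, rfl⟩
  have hp : ∀ x : N, p x = x := fun x => Subtype.ext (hgq x x.2)
  refine ⟨ModuleCat.of R N, j.codRestrict N fun x => hN.prop.1 ⟨x, rfl⟩, ⟨⟨?_⟩, ?_, ?_⟩⟩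
  · intro X Y _ _ _ _ i hi t
    obtain ⟨h, hh⟩ := hJ.out i hi (N.subtype.comp t)
    exact ⟨p.comp h, fun x => by
      change p (h (i x)) = t x
      rw [hh]
      exact hp (t x)⟩
  · intro x y hxy
    exact hj (congrArg Subtype.val hxy)
  · intro x hx
    obtain ⟨r, hr0, m, hm⟩ := hN.prop.2 x.1 x.2 fun h => hx (Subtype.ext h)
    exact ⟨r, fun h => hr0 (congrArg Subtype.val h), m, Subtype.ext hm⟩

/-- The minimal injective cogenerator of a commutative artinian ring `k`: the injective envelope
of `k / rad k`, equivalently of the direct sum of one copy of each simple `k`-module. -/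
def minimalInjectiveCogenerator (k : Type w) [CommRing k] : ModuleCat.{w} k :=
  (exists_injectiveEnvelope k (k ⧸ Ring.jacobson k)).choose

/-- The structure map of the injective envelope `minimalInjectiveCogenerator k`. -/
def minimalInjectiveCogeneratorι (k : Type w) [CommRing k] :
    (k ⧸ Ring.jacobson k) →ₗ[k] minimalInjectiveCogenerator k :=
  (exists_injectiveEnvelope k (k ⧸ Ring.jacobson k)).choose_spec.choose

theorem minimalInjectiveCogeneratorι_spec (k : Type w) [CommRing k] :
    IsInjectiveEnvelope (minimalInjectiveCogeneratorι k) :=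
  (exists_injectiveEnvelope k (k ⧸ Ring.jacobson k)).choose_spec.choose_spec

/-- The duality `D = Hom_k(-, E)`, where `E` is the minimal injective cogenerator of `k`. -/
abbrev MatlisDual (k : Type w) [CommRing k] (M : Type w') [AddCommGroup M] [Module k M] :
    Type max w w' :=
  M →ₗ[k] minimalInjectiveCogenerator k

/-! ### Extensions and complexes with prescribed ends -/

namespace NExangulated

/-- `Ext E Z A` is the `k`-module `𝔼(Z, A)` of extensions of `Z` by `A`. -/
abbrev Ext {k : Type w} [CommRing k] {C : Type u} [Category.{v} C]
    (E : Cᵒᵖ ⥤ C ⥤ ModuleCat.{w'} k) (Z A : C) : Type w' :=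
  (E.obj (op Z)).obj A

/-- `push E a δ` is `a_* δ = 𝔼(Z, a)(δ)`. -/
def push {k : Type w} [CommRing k] {C : Type u} [Category.{v} C]
    (E : Cᵒᵖ ⥤ C ⥤ ModuleCat.{w'} k) {Z A A' : C} (a : A ⟶ A') : Ext E Z A →ₗ[k] Ext E Z A' :=
  ((E.obj (op Z)).map a).hom

/-- `pull E c δ` is `c^* δ = 𝔼(c, A)(δ)`. -/
def pull {k : Type w} [CommRing k] {C : Type u} [Category.{v} C]
    (E : Cᵒᵖ ⥤ C ⥤ ModuleCat.{w'} k) {Z Z' A : C} (c : Z' ⟶ Z) : Ext E Z A →ₗ[k] Ext E Z' A :=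
  ((E.map c.op).app A).hom

/-- A complex `X_0 → X_1 → ⋯ → X_{n+1}` (zero in all other degrees) whose ends `X_0` and `X_{n+1}`
are identified with `A` and `Z`. -/
structure EndedComplex {C : Type u} [Category.{v} C] [Preadditive C] (n : ℕ) (A Z : C) where
  cpx : CochainComplex C ℕ
  isZero : ∀ i, n + 1 < i → IsZero (cpx.X i)
  left : A ≅ cpx.X 0
  right : cpx.X (n + 1) ≅ Z

/-- The first differential `d_0 : A = X_0 → X_1`. -/
def EndedComplex.dFirst {C : Type u} [Category.{v} C] [Preadditive C] {n : ℕ} {A Z : C}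
    (X : EndedComplex n A Z) : A ⟶ X.cpx.X 1 :=
  X.left.hom ≫ X.cpx.d 0 1

/-- The last differential `d_n : X_n → X_{n+1} = Z`. -/
def EndedComplex.dLast {C : Type u} [Category.{v} C] [Preadditive C] {n : ℕ} {A Z : C}
    (X : EndedComplex n A Z) : X.cpx.X n ⟶ Z :=
  X.cpx.d n (n + 1) ≫ X.right.hom

/-- The morphism of complexes `f` is of the form `(a, f_1, …, f_n, c)`. -/
structure EndedComplex.IsLift {C : Type u} [Category.{v} C] [Preadditive C] {n : ℕ}
    {A A' Z Z' : C} {X : EndedComplex n A Z} {Y : EndedComplex n A' Z'} (a : A ⟶ A') (c : Z ⟶ Z')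
    (f : X.cpx ⟶ Y.cpx) : Prop where
  left : X.left.hom ≫ f.f 0 = a ≫ Y.left.hom
  right : f.f (n + 1) ≫ Y.right.hom = X.right.hom ≫ c

/-- Homotopy equivalence of complexes with the same ends, through morphisms of complexes which are
the identity on both ends. -/
def EndedComplex.HomotopyEquivalent {C : Type u} [Category.{v} C] [Preadditive C] {n : ℕ} {A Z : C}
    (X Y : EndedComplex n A Z) : Prop :=
  ∃ (f : X.cpx ⟶ Y.cpx) (g : Y.cpx ⟶ X.cpx), IsLift (𝟙 A) (𝟙 Z) f ∧ IsLift (𝟙 A) (𝟙 Z) g ∧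
    Nonempty (Homotopy (f ≫ g) (𝟙 X.cpx)) ∧ Nonempty (Homotopy (g ≫ f) (𝟙 Y.cpx))

/-- `⟨X, δ⟩` is an `n`-exangle. -/
structure EndedComplex.IsExangle {k : Type w} [CommRing k] {C : Type u} [Category.{v} C]
    [Preadditive C] (E : Cᵒᵖ ⥤ C ⥤ ModuleCat.{w'} k) {n : ℕ} {A Z : C}
    (X : EndedComplex n A Z) (δ : Ext E Z A) : Prop where
  /-- `(d_0)_* δ = 0` -/
  push_eq_zero : push E X.dFirst δ = 0
  /-- `(d_n)^* δ = 0` -/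
  pull_eq_zero : pull E X.dLast δ = 0
  /-- `C(-, X_i) → C(-, X_{i+1}) → C(-, X_{i+2})` is exact for `0 ≤ i < n` -/
  exact_left : ∀ i, i < n → ∀ (W : C) (g : W ⟶ X.cpx.X (i + 1)),
    g ≫ X.cpx.d (i + 1) (i + 2) = 0 → ∃ h : W ⟶ X.cpx.X i, h ≫ X.cpx.d i (i + 1) = g
  /-- `C(-, X_n) → C(-, X_{n+1}) → 𝔼(-, X_0)` is exact -/
  exact_left_last : ∀ (W : C) (g : W ⟶ Z), pull E g δ = 0 → ∃ h : W ⟶ X.cpx.X n, h ≫ X.dLast = g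
  /-- `C(X_{i+2}, -) → C(X_{i+1}, -) → C(X_i, -)` is exact for `0 ≤ i < n` -/
  exact_right : ∀ i, i < n → ∀ (W : C) (g : X.cpx.X (i + 1) ⟶ W),
    X.cpx.d i (i + 1) ≫ g = 0 → ∃ h : X.cpx.X (i + 2) ⟶ W, X.cpx.d (i + 1) (i + 2) ≫ h = g
  /-- `C(X_1, -) → C(X_0, -) → 𝔼(X_{n+1}, -)` is exact -/
  exact_right_first : ∀ (W : C) (g : A ⟶ W), push E g δ = 0 →
    ∃ h : X.cpx.X 1 ⟶ W, X.dFirst ≫ h = g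

/-- `M` is the mapping cone of a morphism `f : X → Y` with `f_0 = 𝟙 A`, i.e. the complex
`X_1 → X_2 ⊕ Y_1 → X_3 ⊕ Y_2 → ⋯ → X_{n+1} ⊕ Y_n → Y_{n+1}` with differentials
`(-d, f)` at the beginning, `(x, y) ↦ (-d x, f x + d y)` in the middle, and `f + d` at the end.
The maps `p i` and `q i` are the projections of `M_i` to `X_{i+1}` and to `Y_i`; the components
`q 0` and `p (n + 1)` play no role. -/
structure EndedComplex.IsMappingCone {C : Type u} [Category.{v} C] [Preadditive C] {n : ℕ}
    {A Z Z' : C} {X : EndedComplex n A Z} {Y : EndedComplex n A Z'} (f : X.cpx ⟶ Y.cpx)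
    (M : EndedComplex n (X.cpx.X 1) Z') where
  p : ∀ i, M.cpx.X i ⟶ X.cpx.X (i + 1)
  q : ∀ i, M.cpx.X i ⟶ Y.cpx.X i
  /-- `M_0 = X_1` -/
  left_p : M.left.hom ≫ p 0 = 𝟙 (X.cpx.X 1)
  /-- `M_i = X_{i+1} ⊕ Y_i` for `1 ≤ i ≤ n` -/
  isLimit : ∀ i, 1 ≤ i → i ≤ n → Nonempty (IsLimit (BinaryFan.mk (p i) (q i)))
  /-- `M_{n+1} = Y_{n+1}` -/
  right_q : q (n + 1) ≫ Y.right.hom = M.right.hom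
  d_p : ∀ i, i < n → M.cpx.d i (i + 1) ≫ p (i + 1) = -(p i ≫ X.cpx.d (i + 1) (i + 2))
  d_q_zero : M.cpx.d 0 1 ≫ q 1 = p 0 ≫ f.f 1
  d_q : ∀ i, 1 ≤ i → i ≤ n →
    M.cpx.d i (i + 1) ≫ q (i + 1) = p i ≫ f.f (i + 1) + q i ≫ Y.cpx.d i (i + 1)

/-- `N` is the mapping cocone of a morphism `h : X → Y` with `h_{n+1} = 𝟙 Z`, i.e. the complex
`X_0 → X_1 ⊕ Y_0 → X_2 ⊕ Y_1 → ⋯ → X_n ⊕ Y_{n-1} → Y_n` with differentials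
`(d, h)` at the beginning, `(x, y) ↦ (d x, h x - d y)` in the middle, and `h - d` at the end.
This is the mapping cone in the opposite category. The maps `p i` and `q i` are the projections
of `N_i` to `X_i` and of `N_{i+1}` to `Y_i`; the component `p (n + 1)` plays no role. -/
structure EndedComplex.IsMappingCocone {C : Type u} [Category.{v} C] [Preadditive C] {n : ℕ}
    {A A' Z : C} {X : EndedComplex n A Z} {Y : EndedComplex n A' Z} (h : X.cpx ⟶ Y.cpx)
    (N : EndedComplex n A (Y.cpx.X n)) where
  p : ∀ i, N.cpx.X i ⟶ X.cpx.X i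
  q : ∀ i, N.cpx.X (i + 1) ⟶ Y.cpx.X i
  /-- `N_0 = X_0` -/
  left_p : N.left.hom ≫ p 0 = X.left.hom
  /-- `N_{i+1} = X_{i+1} ⊕ Y_i` for `0 ≤ i < n` -/
  isLimit : ∀ i, i < n → Nonempty (IsLimit (BinaryFan.mk (p (i + 1)) (q i)))
  /-- `N_{n+1} = Y_n` -/
  right_q : q n = N.right.hom
  d_p : ∀ i, i < n → N.cpx.d i (i + 1) ≫ p (i + 1) = p i ≫ X.cpx.d i (i + 1)
  d_q_zero : N.cpx.d 0 1 ≫ q 0 = p 0 ≫ h.f 0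
  d_q : ∀ i, i < n →
    N.cpx.d (i + 1) (i + 2) ≫ q (i + 1) = p (i + 1) ≫ h.f (i + 1) - q i ≫ Y.cpx.d i (i + 1)

end NExangulated

/-! ### `k`-linear `n`-exangulated categories -/

open NExangulated EndedComplex

/-- The data `(𝔼, 𝔰)` and the axioms of a `k`-linear `n`-exangulated category on a `k`-linear
additive category `C` (for `n ≥ 1`). The realization `𝔰` is given as the relation
`Realizes δ X`, to be read as `𝔰(δ) = [X]`. -/
structure NExangulatedStructure (k : Type w) [CommRing k] (C : Type u) [Category.{v} C]
    [Preadditive C] [Linear k C] (n : ℕ) where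
  /-- The bifunctor `𝔼 : Cᵒᵖ × C → Mod k`. -/
  E : Cᵒᵖ ⥤ C ⥤ ModuleCat.{w'} k
  push_add : ∀ {Z A A' : C} (a b : A ⟶ A') (δ : Ext E Z A),
    push E (a + b) δ = push E a δ + push E b δ
  push_smul : ∀ {Z A A' : C} (r : k) (a : A ⟶ A') (δ : Ext E Z A),
    push E (r • a) δ = r • push E a δ
  pull_add : ∀ {Z Z' A : C} (c d : Z' ⟶ Z) (δ : Ext E Z A),
    pull E (c + d) δ = pull E c δ + pull E d δ
  pull_smul : ∀ {Z Z' A : C} (r : k) (c : Z' ⟶ Z) (δ : Ext E Z A),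
    pull E (r • c) δ = r • pull E c δ
  /-- `X` belongs to the class `𝔰(δ)`. -/
  Realizes : ∀ {A Z : C}, Ext E Z A → EndedComplex n A Z → Prop
  /-- `𝔰(δ)` is a homotopy equivalence class. -/
  exists_realizes : ∀ {A Z : C} (δ : Ext E Z A), ∃ X : EndedComplex n A Z, Realizes δ X
  realizes_iff : ∀ {A Z : C} (δ : Ext E Z A) (X Y : EndedComplex n A Z), Realizes δ X →
    (Realizes δ Y ↔ HomotopyEquivalent X Y)
  /-- (R0) -/
  exists_lift : ∀ {A A' Z Z' : C} (δ : Ext E Z A) (ρ : Ext E Z' A') (X : EndedComplex n A Z)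
    (Y : EndedComplex n A' Z'), Realizes δ X → Realizes ρ Y → ∀ (a : A ⟶ A') (c : Z ⟶ Z'),
    push E a δ = pull E c ρ → ∃ f : X.cpx ⟶ Y.cpx, IsLift a c f
  /-- (R1) -/
  isExangle : ∀ {A Z : C} (δ : Ext E Z A) (X : EndedComplex n A Z), Realizes δ X → X.IsExangle E δ
  /-- (R2): the zero element of `𝔼(0, A)` is realized by `A = A → 0 → ⋯ → 0`. -/
  realizes_zero_left : ∀ {A Z : C}, IsZero Z → ∀ X : EndedComplex n A Z,
    IsIso (X.cpx.d 0 1) → (∀ i, 2 ≤ i → IsZero (X.cpx.X i)) → Realizes 0 X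
  /-- (R2), dual: the zero element of `𝔼(Z, 0)` is realized by `0 → ⋯ → 0 → Z = Z`. -/
  realizes_zero_right : ∀ {A Z : C}, IsZero A → ∀ X : EndedComplex n A Z,
    IsIso (X.cpx.d n (n + 1)) → (∀ i, i < n → IsZero (X.cpx.X i)) → Realizes 0 X
  /-- (EA1): inflations compose, where `f` and `g` are inflations as the first differentials of
  realizations `X` and `Y`. -/
  comp_inflation : ∀ {A B B' Z Z' : C} (f : A ⟶ B) (g : B ⟶ B')
    (δ : Ext E Z A) (X : EndedComplex n A Z) (e : X.cpx.X 1 ≅ B)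
    (ρ : Ext E Z' B) (Y : EndedComplex n B Z') (e' : Y.cpx.X 1 ≅ B'),
    Realizes δ X → X.dFirst ≫ e.hom = f → Realizes ρ Y → Y.dFirst ≫ e'.hom = g →
    ∃ (W : C) (σ : Ext E W A) (V : EndedComplex n A W) (e'' : V.cpx.X 1 ≅ B'),
      Realizes σ V ∧ V.dFirst ≫ e''.hom = f ≫ g
  /-- (EA1), dual: deflations compose. -/
  comp_deflation : ∀ {A A' B Z Z' : C} (f : B ⟶ Z) (g : Z ⟶ Z')
    (δ : Ext E Z A) (X : EndedComplex n A Z) (e : B ≅ X.cpx.X n)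
    (ρ : Ext E Z' A') (Y : EndedComplex n A' Z') (e' : Z ≅ Y.cpx.X n),
    Realizes δ X → e.hom ≫ X.dLast = f → Realizes ρ Y → e'.hom ≫ Y.dLast = g →
    ∃ (W : C) (σ : Ext E Z' W) (V : EndedComplex n W Z') (e'' : B ≅ V.cpx.X n),
      Realizes σ V ∧ e''.hom ≫ V.dLast = f ≫ g
  /-- (EA2): good lifts of `(𝟙, c)` exist. -/
  exists_good_lift : ∀ {A Z Z' : C} (ρ : Ext E Z' A) (c : Z ⟶ Z') (X : EndedComplex n A Z)
    (Y : EndedComplex n A Z'), Realizes (pull E c ρ) X → Realizes ρ Y →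
    ∃ (f : X.cpx ⟶ Y.cpx) (M : EndedComplex n (X.cpx.X 1) Z'), IsLift (𝟙 A) c f ∧
      Nonempty (IsMappingCone f M) ∧ Realizes (push E X.dFirst ρ) M
  /-- (EA2), dual: good lifts of `(a, 𝟙)` exist. -/
  exists_good_colift : ∀ {A A' Z : C} (ρ : Ext E Z A) (a : A ⟶ A') (X : EndedComplex n A Z)
    (Y : EndedComplex n A' Z), Realizes ρ X → Realizes (push E a ρ) Y →
    ∃ (h : X.cpx ⟶ Y.cpx) (N : EndedComplex n A (Y.cpx.X n)), IsLift a (𝟙 Z) h ∧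
      Nonempty (IsMappingCocone h N) ∧ Realizes (pull E Y.dLast ρ) N

/-- Every object is a finite direct sum of objects with local endomorphism rings. -/
def IsKrullSchmidt (C : Type u) [Category.{v} C] [Preadditive C] [HasFiniteBiproducts C] : Prop :=
  ∀ X : C, ∃ (m : ℕ) (Y : Fin m → C), (∀ i, IsLocalRing (End (Y i))) ∧ Nonempty (X ≅ ⨁ Y)

/-- The morphism `f : X → Y` is right `D`-determined: a morphism `g : L → Y` factors through `f`
as soon as `h ≫ g` factors through `f` for every `h : D → L`. -/
def IsRightDetermined {C : Type u} [Category.{v} C] {X Y : C} (f : X ⟶ Y) (D : C) : Prop :=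
  ∀ (L : C) (g : L ⟶ Y), (∀ h : D ⟶ L, ∃ t : D ⟶ X, t ≫ f = h ≫ g) → ∃ t : L ⟶ X, t ≫ f = g

/-- The morphism `f : X → Y` is left `D`-determined: a morphism `g : X → L` factors through `f`
as soon as `g ≫ h` factors through `f` for every `h : L → D`. -/
def IsLeftDetermined {C : Type u} [Category.{v} C] {X Y : C} (f : X ⟶ Y) (D : C) : Prop :=
  ∀ (L : C) (g : X ⟶ L), (∀ h : L ⟶ D, ∃ t : Y ⟶ D, f ≫ t = g ≫ h) → ∃ t : Y ⟶ L, f ≫ t = g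

namespace NExangulatedStructure

/-- `f` is an inflation: it is the first differential of a conflation. -/
def IsInflation {k : Type w} [CommRing k] {C : Type u} [Category.{v} C]
    [Preadditive C] [Linear k C] {n : ℕ} (S : NExangulatedStructure.{w, w'} k C n)
    {A B : C} (f : A ⟶ B) : Prop :=
  ∃ (Z : C) (δ : Ext S.E Z A) (X : EndedComplex n A Z) (e : X.cpx.X 1 ≅ B),
    S.Realizes δ X ∧ X.dFirst ≫ e.hom = f

/-- `g` is a deflation: it is the last differential of a conflation. -/
def IsDeflation {k : Type w} [CommRing k] {C : Type u} [Category.{v} C]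
    [Preadditive C] [Linear k C] {n : ℕ} (S : NExangulatedStructure.{w, w'} k C n)
    {B Z : C} (g : B ⟶ Z) : Prop :=
  ∃ (A : C) (δ : Ext S.E Z A) (X : EndedComplex n A Z) (e : B ≅ X.cpx.X n),
    S.Realizes δ X ∧ e.hom ≫ X.dLast = g

/-- All extension modules are finitely generated over `k`. -/
def IsExtFinite {k : Type w} [CommRing k] {C : Type u} [Category.{v} C]
    [Preadditive C] [Linear k C] {n : ℕ} (S : NExangulatedStructure.{w, w'} k C n) : Prop :=
  ∀ Z A : C, Module.Finite k (Ext S.E Z A)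

/-- Serre duality: a `k`-linear auto-equivalence `τ` of `C` with `k`-linear isomorphisms
`D𝔼(X, Y) ≅ C(Y, τ X)` natural in `X` and `Y`. -/
def HasSerreDuality {k : Type w} [CommRing k] {C : Type u} [Category.{v} C]
    [Preadditive C] [Linear k C] {n : ℕ} (S : NExangulatedStructure.{w, w'} k C n) : Prop :=
  ∃ (τ : C ≌ C) (φ : ∀ X Y : C, MatlisDual k (Ext S.E X Y) ≃ₗ[k] (Y ⟶ τ.functor.obj X)),
    τ.functor.Additive ∧ τ.functor.Linear k ∧
    (∀ (X Y Y' : C) (b : Y' ⟶ Y) (ξ : MatlisDual k (Ext S.E X Y)),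
      φ X Y' (ξ ∘ₗ push S.E b) = b ≫ φ X Y ξ) ∧
    (∀ (X X' Y : C) (a : X ⟶ X') (ξ : MatlisDual k (Ext S.E X Y)),
      φ X' Y (ξ ∘ₗ pull S.E a) = φ X Y ξ ≫ τ.functor.map a)

/-- `Y` is right deflation-classified. The `End(D)ᵐᵒᵖ`-action on `D ⟶ Y` is precomposition. -/
structure IsRightDeflationClassified {k : Type w} [CommRing k] {C : Type u} [Category.{v} C]
    [Preadditive C] [Linear k C] {n : ℕ} (S : NExangulatedStructure.{w, w'} k C n) (Y : C) :
    Prop where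
  exists_determiner : ∀ (X : C) (α : X ⟶ Y), S.IsDeflation α → ∃ D : C, IsRightDetermined α D
  exists_deflation : ∀ (D : C) (H : Submodule (End D)ᵐᵒᵖ (D ⟶ Y)), ∃ (X : C) (α : X ⟶ Y),
    S.IsDeflation α ∧ IsRightDetermined α D ∧ Set.range (fun t : D ⟶ X => t ≫ α) = H

/-- `X` is left inflation-classified. The `End(D)`-action on `X ⟶ D` is postcomposition. -/
structure IsLeftInflationClassified {k : Type w} [CommRing k] {C : Type u} [Category.{v} C]
    [Preadditive C] [Linear k C] {n : ℕ} (S : NExangulatedStructure.{w, w'} k C n) (X : C) :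
    Prop where
  exists_determiner : ∀ (Y : C) (α : X ⟶ Y), S.IsInflation α → ∃ D : C, IsLeftDetermined α D
  exists_inflation : ∀ (D : C) (H : Submodule (End D) (X ⟶ D)), ∃ (Y : C) (α : X ⟶ Y),
    S.IsInflation α ∧ IsLeftDetermined α D ∧ Set.range (fun t : Y ⟶ D => α ≫ t) = H

/-- Each object is right deflation-classified. -/
def HasRightDeterminedDeflations {k : Type w} [CommRing k] {C : Type u} [Category.{v} C]
    [Preadditive C] [Linear k C] {n : ℕ} (S : NExangulatedStructure.{w, w'} k C n) : Prop :=
  ∀ Y : C, S.IsRightDeflationClassified Y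

/-- Each object is left inflation-classified. -/
def HasLeftDeterminedInflations {k : Type w} [CommRing k] {C : Type u} [Category.{v} C]
    [Preadditive C] [Linear k C] {n : ℕ} (S : NExangulatedStructure.{w, w'} k C n) : Prop :=
  ∀ X : C, S.IsLeftInflationClassified X

end NExangulatedStructure

end

/-!
Put `D = Hom_k(-, E)`. A form `ξ ∈ D𝔼(X, A)` is called perfect if `f ↦ ξ ∘ f_*` and `f ↦ ξ ∘ f^*` are
bijections `C(Z, A) → D𝔼(X, Z)` and `C(X, Z) → D𝔼(Z, A)` for all `Z`. Serre duality amounts to the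
existence of perfect forms with a prescribed object in either position
(`HasSerreDuality.exists_isPerfect`, `hasSerreDuality_of_isPerfect`): if `ξ X ∈ D𝔼(X, τ X)` is perfect
for each `X`, then `τ` is a functor by the Yoneda lemma, it is fully faithful because
`C(X, X') ≅ D𝔼(X', τ X) ≅ C(τ X, τ X')`, and it is essentially surjective because each `A` occurs in
a perfect form.

Perfect forms give determined morphisms. Deflations ending at `Y` correspond to extensions
`δ ∈ 𝔼(Y, A)`, a morphism `g` factoring through the deflation if and only if `g^* δ = 0`. If
`𝔼(D, A)` carries a perfect form, then `C(D, Y) ≅ D𝔼(Y, A)`, and by Matlis duality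
(`exists_forall_mem_eq_zero_and_ne_zero`) a submodule `H` of `C(D, Y)` is the annihilator of finitely
many elements of `𝔼(Y, A)`. These are the components of the extension of `Y` by a power of `A` whose
deflation corresponds to `H`.

Conversely, let `X` have a local endomorphism ring. The deflation attached to the radical of
`End X` is realized by an extension of `X`, which has a nonzero component `δ ∈ 𝔼(X, A)` with a local
ring `End A`; it is annihilated by all morphisms to `X` which are not split epimorphisms. By the
exactness properties `exists_push_eq` and `exists_pull_eq`, which come from the mapping cones of
(EA2), `δ` is a push-out of each nonzero extension of `X` and a pull-back of each nonzero extension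
by `A`. A form `ξ` with `ξ δ ≠ 0` is then perfect: the two maps are surjective by Matlis duality, as
the images separate extensions, and they are injective because a nonzero morphism acts
nontrivially on some extension, which is what the determined deflations and inflations attached to
zero submodules say. The Krull–Schmidt property reduces the general case to this one
(`IsPerfect.directSum`).
-/

open NExangulated EndedComplex

/-! ### Matlis duality for modules of finite length -/

section Matlis

variable {k : Type w} [CommRing k]

/-- Functionals into the minimal injective cogenerator extend along injections. The modules may live
in any universe, by Baer's criterion. -/
theorem exists_extension_minimalInjectiveCogenerator {M : Type*} {N : Type*} [AddCommGroup M]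
    [Module k M] [AddCommGroup N] [Module k N] (f : M →ₗ[k] N) (hf : Function.Injective f)
    (g : M →ₗ[k] minimalInjectiveCogenerator k) :
    ∃ h : N →ₗ[k] minimalInjectiveCogenerator k, h ∘ₗ f = g :=
  (Module.Baer.of_injective
    (minimalInjectiveCogeneratorι_spec k).injective).extension_property f hf g

/-- Each simple module embeds into the minimal injective cogenerator. -/
theorem exists_ne_zero_smul_eq_zero [IsArtinianRing k] (m : Ideal k) [hm : m.IsMaximal] :
    ∃ e : minimalInjectiveCogenerator k, e ≠ 0 ∧ ∀ r ∈ m, r • e = 0 := by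
  have hJ : Ring.jacobson k ≤ m := by
    rw [Ring.jacobson_eq_sInf_isMaximal]
    exact sInf_le hm
  -- `k / rad k` is semisimple, so its quotient `k / m` is also a submodule
  have : IsSemisimpleModule k (k ⧸ Ring.jacobson k) :=
    (IsArtinian.isSemisimpleModule_iff_jacobson k _).2 (Module.jacobson_quotient_jacobson k k)
  have : IsSemisimpleModule k (k ⧸ m) :=
    .of_surjective (Submodule.factor hJ) (Submodule.factor_surjective hJ)
  obtain ⟨s, hs⟩ := IsSemisimpleModule.lifting_property (Submodule.factor hJ)
    (Submodule.factor_surjective hJ) LinearMap.id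
  have hs' : Function.Injective s := fun x y h => by
    simpa using (DFunLike.congr_fun hs x).symm.trans
      ((congrArg (Submodule.factor hJ) h).trans (DFunLike.congr_fun hs y))
  refine ⟨minimalInjectiveCogeneratorι k (s (m.mkQ 1)), ?_, fun r hr => ?_⟩
  · rw [Ne, (map_eq_zero_iff _ (minimalInjectiveCogeneratorι_spec k).mono), map_eq_zero_iff _ hs']
    exact fun h => hm.ne_top ((Ideal.eq_top_iff_one m).2 ((Submodule.Quotient.mk_eq_zero m).1 h))
  · rw [← map_smul, ← map_smul, ← map_smul]
    have : m.mkQ (r • 1) = 0 := (Submodule.Quotient.mk_eq_zero m).2 (by simpa using hr)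
    rw [this, map_zero, map_zero]

/-- The minimal injective cogenerator contains each simple module only once. -/
theorem exists_smul_eq_of_smul_eq_zero (m : Ideal k) [hm : m.IsMaximal]
    {x y : minimalInjectiveCogenerator k} (hx : x ≠ 0) (hxm : ∀ r ∈ m, r • x = 0)
    (hym : ∀ r ∈ m, r • y = 0) : ∃ r : k, r • x = y := by
  -- by essentiality, elements with annihilator `m` lie in `k / rad k`
  have key : ∀ z : minimalInjectiveCogenerator k, (∀ r ∈ m, r • z = 0) →
      ∃ a : k, minimalInjectiveCogeneratorι k ((Ring.jacobson k).mkQ a) = z := by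
    intro z hz
    by_cases h0 : z = 0
    · exact ⟨0, by simp [h0]⟩
    obtain ⟨r, hr0, b, hb⟩ := (minimalInjectiveCogeneratorι_spec k).essential z h0
    obtain ⟨b, rfl⟩ := Submodule.mkQ_surjective _ b
    have hrm : r ∉ m := fun h => hr0 (hz r h)
    obtain ⟨t, ht⟩ := hm.exists_inv hrm
    obtain ⟨i, hi, ht⟩ := ht
    refine ⟨t * b, ?_⟩
    rw [← smul_eq_mul, map_smul, map_smul, hb, ← mul_smul, ← add_zero ((t * r) • z), ← hz i hi,
      ← add_smul, ht, one_smul]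
  obtain ⟨a, rfl⟩ := key x hxm
  obtain ⟨b, rfl⟩ := key y hym
  have hι : ∀ c : k, minimalInjectiveCogeneratorι k ((Ring.jacobson k).mkQ c) = 0 ↔
      c ∈ Ring.jacobson k := fun c => by
    rw [map_eq_zero_iff _ (minimalInjectiveCogeneratorι_spec k).mono]
    exact Submodule.Quotient.mk_eq_zero _
  simp only [← map_smul, hι] at hx hxm hym
  -- as `k / rad k` is reduced, `a ∈ m` would force `a = 0` there
  have ham : a ∉ m := by
    intro h
    refine hx ((hι a).2 ?_)
    have := hxm a h
    rw [Ring.jacobson_eq_sInf_isMaximal, Submodule.mem_sInf] at this ⊢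
    intro p hp
    have hp' : Ideal.IsMaximal p := hp
    exact (hp'.isPrime.mem_or_mem (this p hp)).elim id id
  obtain ⟨t, i, hi, ht⟩ := hm.exists_inv ham
  refine ⟨t * b, ?_⟩
  rw [← map_smul, ← map_smul, ← sub_eq_zero, ← map_sub, ← map_sub, hι]
  have := hym (-i) (m.neg_mem hi)
  have e : (t * b) • a - b = -i • b := by
    simp only [smul_eq_mul]
    linear_combination b * ht
  rwa [e]

/-- The injective module `minimalInjectiveCogenerator k` is a cogenerator. -/
theorem exists_matlisDual_ne_zero [IsArtinianRing k] {M : Type*} [AddCommGroup M] [Module k M]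
    {x : M} (hx : x ≠ 0) : ∃ ξ : MatlisDual k M, ξ x ≠ 0 := by
  let f := LinearMap.toSpanSingleton k M x
  have hne : LinearMap.ker f ≠ ⊤ := by
    rw [Ne, Ideal.eq_top_iff_one]
    simpa [f] using hx
  obtain ⟨m, hm, hle⟩ := Ideal.exists_le_maximal _ hne
  obtain ⟨e, he, hme⟩ := exists_ne_zero_smul_eq_zero m
  obtain ⟨ξ, hξ⟩ := exists_extension_minimalInjectiveCogenerator
    ((LinearMap.ker f).liftQ f le_rfl) (LinearMap.ker_eq_bot.1 (Submodule.ker_liftQ_eq_bot' _ _ rfl))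
    ((LinearMap.ker f).liftQ (LinearMap.toSpanSingleton k _ e) fun r hr => hme r (hle hr))
  have h : ξ ((1 : k) • x) = (1 : k) • e := DFunLike.congr_fun hξ ((LinearMap.ker f).mkQ 1)
  rw [one_smul, one_smul] at h
  exact ⟨ξ, h ▸ he⟩

/-- Every functional on the dual of a simple module is the evaluation at an element. -/
theorem exists_forall_matlisDual_apply_eq_of_isSimpleModule [IsArtinianRing k] {M : Type*}
    [AddCommGroup M] [Module k M] [IsSimpleModule k M] (Λ : MatlisDual k (MatlisDual k M)) :
    ∃ x : M, ∀ ξ : MatlisDual k M, Λ ξ = ξ x := by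
  have := IsSimpleModule.nontrivial k M
  obtain ⟨y, hy⟩ := exists_ne (0 : M)
  have hspan := IsSimpleModule.toSpanSingleton_surjective k hy
  let m : Ideal k := LinearMap.ker (LinearMap.toSpanSingleton k (M) y)
  have hm : m.IsMaximal := IsSimpleModule.ker_toSpanSingleton_isMaximal k hy
  have hmy : ∀ r ∈ m, r • y = 0 := fun r hr => hr
  have hmk : ∀ r ∈ m, ∀ ξ : MatlisDual k (M), r • ξ = 0 := by
    intro r hr ξ
    refine LinearMap.ext fun z => ?_
    obtain ⟨t, rfl⟩ := hspan z
    have : r • t • y = 0 := by rw [smul_comm, hmy r hr, smul_zero]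
    rw [LinearMap.toSpanSingleton_apply, LinearMap.smul_apply, ← map_smul, this, map_zero,
      LinearMap.zero_apply]
  have hmul : ∀ ξ ζ : MatlisDual k (M), ξ y = ζ y → ξ = ζ := by
    intro ξ ζ h
    refine LinearMap.ext fun z => ?_
    obtain ⟨t, rfl⟩ := hspan z
    simp [h]
  obtain ⟨ξ₀, hξ₀⟩ := exists_matlisDual_ne_zero (k := k) hy
  have hk : ∀ r ∈ m, ∀ ξ : MatlisDual k (M), r • ξ y = 0 := fun r hr ξ => by
    rw [← map_smul, hmy r hr, map_zero]
  obtain ⟨r, hr⟩ := exists_smul_eq_of_smul_eq_zero m hξ₀ (fun r hr => hk r hr ξ₀)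
    (fun r hr => by rw [← map_smul, hmk r hr, map_zero]) (y := Λ ξ₀)
  refine ⟨r • y, fun ξ => ?_⟩
  obtain ⟨t, ht⟩ := exists_smul_eq_of_smul_eq_zero m hξ₀ (fun r hr => hk r hr ξ₀)
    (fun r hr => hk r hr ξ)
  obtain rfl : t • ξ₀ = ξ := hmul _ _ (by simpa using ht)
  rw [map_smul, ← hr, LinearMap.smul_apply, map_smul]

/-- Every functional on the dual of a module of finite length is the evaluation at an element. -/
theorem exists_forall_matlisDual_apply_eq [IsArtinianRing k] {M : Type*} [AddCommGroup M]
    [Module k M] (hM : IsFiniteLength k M) (Λ : MatlisDual k (MatlisDual k M)) :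
    ∃ x : M, ∀ ξ : MatlisDual k M, Λ ξ = ξ x := by
  induction hM with
  | of_subsingleton =>
    refine ⟨0, fun ξ => ?_⟩
    have : ξ = 0 := LinearMap.ext fun x => by rw [Subsingleton.elim x 0, map_zero, map_zero]
    rw [this, map_zero, LinearMap.zero_apply]
  | @of_simple_quotient M _ _ N hS _ ih =>
    obtain ⟨x, hx⟩ := exists_forall_matlisDual_apply_eq_of_isSimpleModule
      (Λ ∘ₗ LinearMap.lcomp k _ N.mkQ)
    obtain ⟨x, rfl⟩ := N.mkQ_surjective x
    -- after subtracting an evaluation, `Λ` is induced from the dual of `N`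
    let Λ₁ : MatlisDual k (MatlisDual k M) := Λ - LinearMap.applyₗ x
    let ρ : MatlisDual k M →ₗ[k] MatlisDual k N := LinearMap.lcomp k _ N.subtype
    have hρ : Function.Surjective ρ := fun ζ =>
      exists_extension_minimalInjectiveCogenerator N.subtype N.subtype_injective ζ
    have hker : LinearMap.ker ρ ≤ LinearMap.ker Λ₁ := by
      intro ξ hξ
      have hN : N ≤ LinearMap.ker ξ := fun z hz => DFunLike.congr_fun hξ (⟨z, hz⟩ : N)
      have := hx (N.liftQ ξ hN)
      have e : LinearMap.lcomp k _ N.mkQ (N.liftQ ξ hN) = ξ := N.liftQ_mkQ ξ hN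
      rw [LinearMap.comp_apply, e] at this
      simp [Λ₁, this]
    obtain ⟨z, hz⟩ := ih ((LinearMap.ker ρ).liftQ Λ₁ hker ∘ₗ (ρ.quotKerEquivOfSurjective hρ).symm)
    refine ⟨x + z, fun ξ => ?_⟩
    have h1 := hz (ρ ξ)
    have h2 : (ρ.quotKerEquivOfSurjective hρ).symm (ρ ξ) = (LinearMap.ker ρ).mkQ ξ := by
      rw [LinearEquiv.symm_apply_eq]
      rfl
    rw [LinearMap.comp_apply, LinearEquiv.coe_coe, h2] at h1
    have h3 : Λ ξ - ξ x = ξ z := h1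
    rw [map_add, ← h3]
    abel

/-- A submodule of the dual of a finitely generated module is cut out by elements of the module. -/
theorem exists_forall_mem_eq_zero_and_ne_zero [IsArtinianRing k] {M : Type*} [AddCommGroup M]
    [Module k M] [Module.Finite k M] (K : Submodule k (MatlisDual k M)) {ξ : MatlisDual k M}
    (hξ : ξ ∉ K) : ∃ x : M, (∀ ζ ∈ K, ζ x = 0) ∧ ξ x ≠ 0 := by
  have hlen : IsFiniteLength k M :=
    isFiniteLength_iff_isNoetherian_isArtinian.2 ⟨inferInstance, inferInstance⟩
  obtain ⟨Λ, hΛ⟩ := exists_matlisDual_ne_zero (k := k) (x := K.mkQ ξ) (by simpa using hξ)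
  obtain ⟨x, hx⟩ := exists_forall_matlisDual_apply_eq hlen (Λ ∘ₗ K.mkQ)
  refine ⟨x, fun ζ hζ => ?_, fun h => hΛ ?_⟩
  · have : K.mkQ ζ = 0 := by simpa using hζ
    rw [← hx, LinearMap.comp_apply, this, map_zero]
  · rw [← h, ← hx, LinearMap.comp_apply]

end Matlis

/-! ### Extensions as a bifunctor -/

namespace NExangulated

variable {k : Type w} [CommRing k] {C : Type u} [Category.{v} C] (E : Cᵒᵖ ⥤ C ⥤ ModuleCat.{w'} k)

theorem push_id {Z A : C} (δ : Ext E Z A) : push E (𝟙 A) δ = δ := by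
  simp [push]

theorem pull_id {Z A : C} (δ : Ext E Z A) : pull E (𝟙 Z) δ = δ := by
  simp [pull]

theorem push_comp {Z A A' A'' : C} (a : A ⟶ A') (b : A' ⟶ A'') (δ : Ext E Z A) :
    push E (a ≫ b) δ = push E b (push E a δ) := by
  simp [push]

theorem pull_comp {Z Z' Z'' A : C} (c : Z'' ⟶ Z') (d : Z' ⟶ Z) (δ : Ext E Z A) :
    pull E (c ≫ d) δ = pull E c (pull E d δ) := by
  simp [pull]

theorem push_pull {Z Z' A A' : C} (a : A ⟶ A') (c : Z' ⟶ Z) (δ : Ext E Z A) :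
    push E a (pull E c δ) = pull E c (push E a δ) :=
  (ConcreteCategory.congr_hom ((E.map c.op).naturality a) δ).symm

end NExangulated

namespace NExangulatedStructure

variable {k : Type w} [CommRing k] {C : Type u} [Category.{v} C] [Preadditive C] [Linear k C]
  {n : ℕ} (S : NExangulatedStructure.{w, w'} k C n)

theorem push_zero {Z A A' : C} (δ : Ext S.E Z A) : push S.E (0 : A ⟶ A') δ = 0 := by
  simpa using S.push_smul (0 : k) (0 : A ⟶ A') δ

theorem pull_zero {Z Z' A : C} (δ : Ext S.E Z A) : pull S.E (0 : Z' ⟶ Z) δ = 0 := by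
  simpa using S.pull_smul (0 : k) (0 : Z' ⟶ Z) δ

theorem push_sum {ι : Type*} (s : Finset ι) {Z A A' : C} (a : ι → (A ⟶ A')) (δ : Ext S.E Z A) :
    push S.E (∑ i ∈ s, a i) δ = ∑ i ∈ s, push S.E (a i) δ := by
  induction s using Finset.cons_induction with
  | empty => simp [push_zero]
  | cons i s hi ih => rw [Finset.sum_cons, Finset.sum_cons, S.push_add, ih]

theorem pull_sum {ι : Type*} (s : Finset ι) {Z Z' A : C} (c : ι → (Z' ⟶ Z)) (δ : Ext S.E Z A) :
    pull S.E (∑ i ∈ s, c i) δ = ∑ i ∈ s, pull S.E (c i) δ := by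
  induction s using Finset.cons_induction with
  | empty => simp [pull_zero]
  | cons i s hi ih => rw [Finset.sum_cons, Finset.sum_cons, S.pull_add, ih]

theorem push_neg {Z A A' : C} (a : A ⟶ A') (δ : Ext S.E Z A) :
    push S.E (-a) δ = -push S.E a δ := by
  simpa using S.push_smul (-1 : k) a δ

theorem pull_neg {Z Z' A : C} (c : Z' ⟶ Z) (δ : Ext S.E Z A) :
    pull S.E (-c) δ = -pull S.E c δ := by
  simpa using S.pull_smul (-1 : k) c δ

/-! ### Deflations, inflations and the extensions they realize -/

/-- The morphisms factoring through a deflation are those annihilating an extension. -/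
theorem IsDeflation.exists_ext {S : NExangulatedStructure.{w, w'} k C n} {X Y : C} {α : X ⟶ Y}
    (h : S.IsDeflation α) : ∃ (A : C) (δ : Ext S.E Y A), ∀ (L : C) (g : L ⟶ Y),
      (∃ t : L ⟶ X, t ≫ α = g) ↔ pull S.E g δ = 0 := by
  obtain ⟨A, δ, V, e, hV, rfl⟩ := h
  have hex := S.isExangle δ V hV
  refine ⟨A, δ, fun L g => ⟨?_, fun hg => ?_⟩⟩
  · rintro ⟨t, rfl⟩
    rw [pull_comp, pull_comp, hex.pull_eq_zero, map_zero, map_zero]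
  · obtain ⟨t, ht⟩ := hex.exact_left_last L g hg
    exact ⟨t ≫ e.inv, by simpa using ht⟩

/-- Each extension is realized by a deflation. -/
theorem exists_isDeflation {Y A : C} (δ : Ext S.E Y A) : ∃ (X : C) (α : X ⟶ Y), S.IsDeflation α ∧
    ∀ (L : C) (g : L ⟶ Y), (∃ t : L ⟶ X, t ≫ α = g) ↔ pull S.E g δ = 0 := by
  obtain ⟨V, hV⟩ := S.exists_realizes δ
  have hex := S.isExangle δ V hV
  refine ⟨_, V.dLast, ⟨A, δ, V, Iso.refl _, hV, Category.id_comp _⟩, fun L g => ⟨?_, fun hg => ?_⟩⟩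
  · rintro ⟨t, rfl⟩
    rw [pull_comp, hex.pull_eq_zero, map_zero]
  · exact hex.exact_left_last L g hg

/-- The morphisms factoring through an inflation are those annihilating an extension. -/
theorem IsInflation.exists_ext {S : NExangulatedStructure.{w, w'} k C n} {X Y : C} {α : X ⟶ Y}
    (h : S.IsInflation α) : ∃ (Z : C) (δ : Ext S.E Z X), ∀ (L : C) (g : X ⟶ L),
      (∃ t : Y ⟶ L, α ≫ t = g) ↔ push S.E g δ = 0 := by
  obtain ⟨Z, δ, V, e, hV, rfl⟩ := h
  have hex := S.isExangle δ V hV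
  refine ⟨Z, δ, fun L g => ⟨?_, fun hg => ?_⟩⟩
  · rintro ⟨t, rfl⟩
    rw [push_comp, push_comp, hex.push_eq_zero, map_zero, map_zero]
  · obtain ⟨t, ht⟩ := hex.exact_right_first L g hg
    exact ⟨e.inv ≫ t, by simpa using ht⟩

/-- Each extension is realized by an inflation. -/
theorem exists_isInflation {X Z : C} (δ : Ext S.E Z X) : ∃ (Y : C) (α : X ⟶ Y), S.IsInflation α ∧
    ∀ (L : C) (g : X ⟶ L), (∃ t : Y ⟶ L, α ≫ t = g) ↔ push S.E g δ = 0 := by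
  obtain ⟨V, hV⟩ := S.exists_realizes δ
  have hex := S.isExangle δ V hV
  refine ⟨_, V.dFirst, ⟨Z, δ, V, Iso.refl _, hV, Category.comp_id _⟩, fun L g => ⟨?_, fun hg => ?_⟩⟩
  · rintro ⟨t, rfl⟩
    rw [push_comp, hex.push_eq_zero, map_zero]
  · exact hex.exact_right_first L g hg

/-- Exactness of `C(Y, Z) → 𝔼(Y, A) → 𝔼(Y, X_1)` for a conflation `A → X_1 → ⋯ → Z` realizing `ρ`.
The kernel of the second map is described without reference to the conflation: an extension dies in
`𝔼(Y, X_1)` if and only if it is annihilated by all the morphisms annihilating `ρ`. -/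
theorem exists_pull_eq [HasBinaryBiproducts C] {A Y Z : C} (hn : 1 ≤ n) (ρ : Ext S.E Z A)
    (δ : Ext S.E Y A)
    (h : ∀ (W : C) (g : A ⟶ W), push S.E g ρ = 0 → push S.E g δ = 0) :
    ∃ c : Y ⟶ Z, pull S.E c ρ = δ := by
  -- the mapping cone over `Z → Z ⊞ Y` realizes the push-out of `(ρ, δ)` to `X_1`, which is zero
  let σ : Ext S.E (Z ⊞ Y) A := pull S.E biprod.fst ρ + pull S.E biprod.snd δ
  have hl : pull S.E biprod.inl σ = ρ := by
    simp [σ, ← pull_comp, pull_id, pull_zero]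
  have hr : pull S.E biprod.inr σ = δ := by
    simp [σ, ← pull_comp, pull_id, pull_zero]
  obtain ⟨X, hX⟩ := S.exists_realizes ρ
  obtain ⟨V, hV⟩ := S.exists_realizes σ
  obtain ⟨f, M, hf, ⟨hM⟩, hMr⟩ := S.exists_good_lift σ biprod.inl X V (hl.symm ▸ hX) hV
  have h0 : push S.E X.dFirst ρ = 0 := (S.isExangle ρ X hX).push_eq_zero
  have hσ : push S.E X.dFirst σ = 0 := by
    simp [σ, push_pull, h0, h _ _ h0]
  obtain ⟨s, hs⟩ := (S.isExangle _ M hMr).exact_left_last Y biprod.inr (by rw [hσ, map_zero])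
  -- hence its last differential splits, and a lift of `Y` along it has components in `Z` and `V_n`
  have hd : M.dLast = hM.p n ≫ X.right.hom ≫ biprod.inl + hM.q n ≫ V.dLast := by
    rw [EndedComplex.dLast, ← hM.right_q, ← Category.assoc, hM.d_q n hn le_rfl, Preadditive.add_comp,
      Category.assoc, hf.right, Category.assoc]
    rfl
  refine ⟨s ≫ hM.p n ≫ X.right.hom, ?_⟩
  rw [hd, Preadditive.comp_add] at hs
  rw [← hr, ← hs, S.pull_add, pull_comp _ s (hM.q n ≫ _), pull_comp _ (hM.q n),
    (S.isExangle _ V hV).pull_eq_zero, map_zero, map_zero, add_zero]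
  simp only [← Category.assoc]
  rw [pull_comp _ _ biprod.inl, hl]

/-- Exactness of `C(A, A') → 𝔼(Z, A') → 𝔼(X_n, A')` for a conflation `A → ⋯ → X_n → Z` realizing
`ρ`, dual to `exists_pull_eq`. -/
theorem exists_push_eq [HasBinaryBiproducts C] {A A' Z : C} (hn : 1 ≤ n) (ρ : Ext S.E Z A)
    (δ : Ext S.E Z A')
    (h : ∀ (W : C) (g : W ⟶ Z), pull S.E g ρ = 0 → pull S.E g δ = 0) :
    ∃ a : A ⟶ A', push S.E a ρ = δ := by
  let σ : Ext S.E Z (A ⊞ A') := push S.E biprod.inl ρ + push S.E biprod.inr δ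
  have hl : push S.E biprod.fst σ = ρ := by
    simp [σ, ← push_comp, push_id, push_zero]
  have hr : push S.E biprod.snd σ = δ := by
    simp [σ, ← push_comp, push_id, push_zero]
  obtain ⟨X, hX⟩ := S.exists_realizes σ
  obtain ⟨V, hV⟩ := S.exists_realizes ρ
  obtain ⟨f, N, hf, ⟨hN⟩, hNr⟩ := S.exists_good_colift σ biprod.fst X V hX (hl.symm ▸ hV)
  have h0 : pull S.E V.dLast ρ = 0 := (S.isExangle ρ V hV).pull_eq_zero
  have hσ : pull S.E V.dLast σ = 0 := by
    simp [σ, ← push_pull, h0, h _ _ h0]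
  obtain ⟨s, hs⟩ := (S.isExangle _ N hNr).exact_right_first A' biprod.snd (by rw [hσ, map_zero])
  -- the extension `s` of `A ⊞ A' → A'` to `N_1 = X_1 ⊕ V_0` splits into components
  obtain ⟨lim⟩ := hN.isLimit 0 hn
  have hsplit : ∃ (u : X.cpx.X 1 ⟶ A') (t : V.cpx.X 0 ⟶ A'), s = hN.p 1 ≫ u + hN.q 0 ≫ t := by
    let i : X.cpx.X 1 ⟶ N.cpx.X 1 := lim.lift (BinaryFan.mk (𝟙 _) 0)
    let j : V.cpx.X 0 ⟶ N.cpx.X 1 := lim.lift (BinaryFan.mk 0 (𝟙 _))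
    have i1 : i ≫ hN.p 1 = 𝟙 _ := lim.fac _ ⟨WalkingPair.left⟩
    have i2 : i ≫ hN.q 0 = 0 := lim.fac _ ⟨WalkingPair.right⟩
    have j1 : j ≫ hN.p 1 = 0 := lim.fac _ ⟨WalkingPair.left⟩
    have j2 : j ≫ hN.q 0 = 𝟙 _ := lim.fac _ ⟨WalkingPair.right⟩
    have hid : hN.p 1 ≫ i + hN.q 0 ≫ j = 𝟙 _ := by
      refine BinaryFan.IsLimit.hom_ext lim ?_ ?_
      · change (_ + _) ≫ hN.p 1 = 𝟙 _ ≫ hN.p 1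
        simp [i1, j1]
      · change (_ + _) ≫ hN.q 0 = 𝟙 _ ≫ hN.q 0
        simp [i2, j2]
    refine ⟨i ≫ s, j ≫ s, ?_⟩
    rw [← Category.assoc, ← Category.assoc, ← Preadditive.add_comp, hid, Category.id_comp]
  obtain ⟨u, t, rfl⟩ := hsplit
  have hp : N.dFirst ≫ hN.p 1 = X.dFirst := by
    rw [EndedComplex.dFirst, Category.assoc, hN.d_p 0 hn, ← Category.assoc, hN.left_p]
    rfl
  have hq : N.dFirst ≫ hN.q 0 = biprod.fst ≫ V.left.hom := by
    rw [EndedComplex.dFirst, Category.assoc, hN.d_q_zero, ← Category.assoc, hN.left_p, hf.left]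
  refine ⟨V.left.hom ≫ t, ?_⟩
  rw [Preadditive.comp_add, ← Category.assoc, ← Category.assoc, hp, hq] at hs
  rw [← hr, ← hs, S.push_add, push_comp _ X.dFirst, (S.isExangle _ X hX).push_eq_zero, map_zero,
    zero_add, Category.assoc, push_comp _ biprod.fst, hl]

end NExangulatedStructure

/-! ### Objects with local endomorphism rings -/

section Local

variable {C : Type u} [Category.{v} C] [Preadditive C] {X : C} [IsLocalRing (End X)]

theorem isIso_or_isIso_of_add_eq_id {f g : X ⟶ X} (h : f + g = 𝟙 X) : IsIso f ∨ IsIso g := by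
  rw [← isUnit_iff_isIso, ← isUnit_iff_isIso]
  exact IsLocalRing.isUnit_or_isUnit_of_add_one h

theorem id_ne_zero_of_isLocalRing_end (X : C) [IsLocalRing (End X)] : 𝟙 X ≠ 0 :=
  one_ne_zero (α := End X)

theorem isIso_and_isIso_of_comp_eq_id {f g : X ⟶ X} (h : f ≫ g = 𝟙 X) : IsIso f ∧ IsIso g := by
  have hp : (g ≫ f) ≫ (g ≫ f) = g ≫ f := by
    rw [Category.assoc, reassoc_of% h]
  -- the idempotent `g ≫ f` is trivial, and cannot vanish
  suffices g ≫ f = 𝟙 X from ⟨⟨g, h, this⟩, ⟨f, this, h⟩⟩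
  rcases isIso_or_isIso_of_add_eq_id (add_sub_cancel (g ≫ f) (𝟙 X)) with hi | hi
  · rw [← cancel_mono (g ≫ f), hp, Category.id_comp]
  · refine absurd ?_ (id_ne_zero_of_isLocalRing_end X)
    have h0 : g ≫ f = 0 := by
      rw [← cancel_mono (𝟙 X - g ≫ f), zero_comp, Preadditive.comp_sub, hp, Category.comp_id,
        sub_self]
    calc 𝟙 X = f ≫ (g ≫ f) ≫ g := by rw [Category.assoc, h, Category.comp_id, h]
      _ = 0 := by rw [h0, zero_comp, comp_zero]

theorem isIso_or_isIso_of_isIso_add {f g : X ⟶ X} [IsIso (f + g)] : IsIso f ∨ IsIso g := by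
  have h : inv (f + g) ≫ f + inv (f + g) ≫ g = 𝟙 X := by
    rw [← Preadditive.comp_add, IsIso.inv_hom_id]
  refine (isIso_or_isIso_of_add_eq_id h).imp (fun hi => ?_) (fun hi => ?_)
  · simpa using IsIso.comp_isIso' (f := f + g) inferInstance hi
  · simpa using IsIso.comp_isIso' (f := f + g) inferInstance hi

theorem isIso_of_isIso_comp_left {f g : X ⟶ X} [IsIso (f ≫ g)] : IsIso f :=
  (isIso_and_isIso_of_comp_eq_id (g := g ≫ inv (f ≫ g))
    (by rw [← Category.assoc, IsIso.hom_inv_id])).1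

theorem isIso_of_isIso_comp_right {f g : X ⟶ X} [IsIso (f ≫ g)] : IsIso g :=
  (isIso_and_isIso_of_comp_eq_id (f := inv (f ≫ g) ≫ f)
    (by rw [Category.assoc, IsIso.inv_hom_id])).2

variable (X) in
theorem not_isIso_zero_of_isLocalRing_end : ¬ IsIso (0 : X ⟶ X) := fun h =>
  id_ne_zero_of_isLocalRing_end X (by rw [← IsIso.hom_inv_id (0 : X ⟶ X), zero_comp])

variable (X) in
/-- The radical of a local endomorphism ring, as a right ideal. -/
def radicalPrecomp : Submodule (End X)ᵐᵒᵖ (X ⟶ X) where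
  carrier := {f | ¬ IsIso f}
  zero_mem' := not_isIso_zero_of_isLocalRing_end X
  add_mem' hf hg := fun _ => isIso_or_isIso_of_isIso_add.elim hf hg
  smul_mem' r f hf := fun (_ : IsIso (r.unop ≫ f)) => hf (isIso_of_isIso_comp_right (f := r.unop))

variable (X) in
/-- The radical of a local endomorphism ring, as a left ideal. -/
def radicalPostcomp : Submodule (End X) (X ⟶ X) where
  carrier := {f | ¬ IsIso f}
  zero_mem' := not_isIso_zero_of_isLocalRing_end X
  add_mem' hf hg := fun _ => isIso_or_isIso_of_isIso_add.elim hf hg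
  smul_mem' r f hf := fun (_ : IsIso (f ≫ r)) => hf (isIso_of_isIso_comp_left (g := r))

end Local

/-- The morphisms `ι j : Y j ⟶ X` and `π j : X ⟶ Y j` exhibit `X` as the direct sum of the family
`Y`. -/
structure IsDirectSum {C : Type u} [Category.{v} C] [Preadditive C] {J : Type*} [Fintype J] {X : C}
    {Y : J → C} (ι : ∀ j, Y j ⟶ X) (π : ∀ j, X ⟶ Y j) : Prop where
  ι_π_self : ∀ j, ι j ≫ π j = 𝟙 (Y j)
  ι_π_of_ne : ∀ i j, i ≠ j → ι i ≫ π j = 0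
  total : ∑ j, π j ≫ ι j = 𝟙 X

theorem IsDirectSum.biproduct {C : Type u} [Category.{v} C] [Preadditive C] [HasFiniteBiproducts C]
    {m : ℕ} (Y : Fin m → C) : IsDirectSum (biproduct.ι Y) (biproduct.π Y) where
  ι_π_self j := biproduct.ι_π_self Y j
  ι_π_of_ne _ _ h := biproduct.ι_π_ne Y h
  total := biproduct.total

theorem IsKrullSchmidt.exists_isDirectSum {C : Type u} [Category.{v} C] [Preadditive C]
    [HasFiniteBiproducts C] (h : IsKrullSchmidt C) (X : C) :
    ∃ (m : ℕ) (Y : Fin m → C) (ι : ∀ j, Y j ⟶ X) (π : ∀ j, X ⟶ Y j),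
      (∀ j, IsLocalRing (End (Y j))) ∧ IsDirectSum ι π := by
  obtain ⟨m, Y, hY, ⟨e⟩⟩ := h X
  refine ⟨m, Y, fun j => biproduct.ι Y j ≫ e.inv, fun j => e.hom ≫ biproduct.π Y j, hY, ?_, ?_, ?_⟩
  · intro j
    simp
  · intro i j hij
    simp [biproduct.ι_π_ne Y hij]
  · calc ∑ j, (e.hom ≫ biproduct.π Y j) ≫ biproduct.ι Y j ≫ e.inv
        = e.hom ≫ (∑ j, biproduct.π Y j ≫ biproduct.ι Y j) ≫ e.inv := by
          simp only [Preadditive.comp_sum, Preadditive.sum_comp, Category.assoc]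
      _ = 𝟙 X := by simp

namespace NExangulatedStructure

variable {k : Type w} [CommRing k] {C : Type u} [Category.{v} C] [Preadditive C] [Linear k C]
  {n : ℕ} (S : NExangulatedStructure.{w, w'} k C n)

theorem eq_zero_of_push_eq_zero {Z A A' : C} (a : A ⟶ A') [IsIso a] {δ : Ext S.E Z A}
    (h : push S.E a δ = 0) : δ = 0 := by
  rw [← push_id S.E δ, ← IsIso.hom_inv_id a, push_comp, h, map_zero]

theorem eq_zero_of_pull_eq_zero {Z Z' A : C} (c : Z' ⟶ Z) [IsIso c] {δ : Ext S.E Z A}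
    (h : pull S.E c δ = 0) : δ = 0 := by
  rw [← pull_id S.E δ, ← IsIso.inv_hom_id c, pull_comp, h, map_zero]

theorem exists_push_ne_zero {J : Type*} [Fintype J] {Z A : C} {Y : J → C} {ι : ∀ j, Y j ⟶ A}
    {π : ∀ j, A ⟶ Y j} (h : IsDirectSum ι π) {δ : Ext S.E Z A} (hδ : δ ≠ 0) :
    ∃ j, push S.E (π j) δ ≠ 0 := by
  by_contra! h0
  refine hδ ?_
  rw [← push_id S.E δ, ← h.total, push_sum]
  exact Finset.sum_eq_zero fun j _ => by rw [push_comp, h0, map_zero]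

theorem exists_pull_ne_zero {J : Type*} [Fintype J] {Z A : C} {Y : J → C} {ι : ∀ j, Y j ⟶ Z}
    {π : ∀ j, Z ⟶ Y j} (h : IsDirectSum ι π) {δ : Ext S.E Z A} (hδ : δ ≠ 0) :
    ∃ j, pull S.E (ι j) δ ≠ 0 := by
  by_contra! h0
  refine hδ ?_
  rw [← pull_id S.E δ, ← h.total, pull_sum]
  exact Finset.sum_eq_zero fun j _ => by rw [pull_comp, h0, map_zero]

/-! ### Almost split extensions -/

/-- The nonzero extension `δ` of `X` by `A` is almost split, in the form used for duality: it is a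
push-out of each nonzero extension of `X`, and a pull-back of each nonzero extension by `A`. -/
structure IsAlmostSplit {S : NExangulatedStructure.{w, w'} k C n} {X A : C} (δ : Ext S.E X A) :
    Prop where
  ne_zero : δ ≠ 0
  exists_push : ∀ (Z : C) (η : Ext S.E X Z), η ≠ 0 → ∃ h : Z ⟶ A, push S.E h η = δ
  exists_pull : ∀ (Z : C) (η : Ext S.E Z A), η ≠ 0 → ∃ h : X ⟶ Z, pull S.E h η = δ

/-- The extension realized by the right `X`-determined deflation attached to the radical of `End X`
has an almost split component. -/
theorem HasRightDeterminedDeflations.exists_isAlmostSplit [HasFiniteBiproducts C]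
    {S : NExangulatedStructure.{w, w'} k C n} (hR : S.HasRightDeterminedDeflations) (hn : 1 ≤ n)
    (hKS : IsKrullSchmidt C) (X : C) [IsLocalRing (End X)] :
    ∃ (A : C) (δ : Ext S.E X A), IsAlmostSplit δ := by
  have := HasBinaryBiproducts.of_hasBinaryProducts (C := C)
  obtain ⟨B, α, hα, hdet, hH⟩ := (hR X).exists_deflation X (radicalPrecomp X)
  obtain ⟨A', δ', hδ'⟩ := hα.exists_ext
  have hmem : ∀ f : X ⟶ X, (∃ t, t ≫ α = f) ↔ ¬ IsIso f := fun f =>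
    (Set.ext_iff.1 hH f :)
  have hann : ∀ (L : C) (g : L ⟶ X), (∀ h : X ⟶ L, ¬ IsIso (h ≫ g)) → pull S.E g δ' = 0 :=
    fun L g hg => (hδ' L g).1 (hdet L g fun h => (hmem _).2 (hg h))
  have hne : δ' ≠ 0 := fun h0 => (hmem (𝟙 X)).1 ((hδ' X _).2 (by rw [h0, map_zero])) inferInstance
  obtain ⟨m, Y, ι, π, hY, hsum⟩ := hKS.exists_isDirectSum A'
  obtain ⟨j, hj⟩ := S.exists_push_ne_zero hsum hne
  have := hY j
  have hpush : ∀ (Z : C) (η : Ext S.E X Z), η ≠ 0 →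
      ∃ h : Z ⟶ Y j, push S.E h η = push S.E (π j) δ' := by
    intro Z η hη
    refine S.exists_push_eq hn η _ fun W g hg => ?_
    rw [← push_pull, hann W g fun h hi => hη ?_, map_zero]
    exact S.eq_zero_of_pull_eq_zero (h ≫ g) (by rw [pull_comp, hg, map_zero])
  refine ⟨Y j, push S.E (π j) δ', hj, hpush, fun Z η hη => S.exists_pull_eq hn η _ ?_⟩
  intro W g hg
  by_contra h0
  obtain ⟨h, hh⟩ := hpush W _ h0
  -- `g ≫ h` fixes a nonzero extension, hence is invertible, and `g` kills no nonzero extension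
  rcases isIso_or_isIso_of_add_eq_id (add_sub_cancel (g ≫ h) (𝟙 (Y j))) with hi | hi
  · exact hη (S.eq_zero_of_push_eq_zero (g ≫ h) (by rw [push_comp, hg, map_zero]))
  · refine hj (S.eq_zero_of_push_eq_zero (𝟙 _ - g ≫ h) ?_)
    rw [sub_eq_add_neg, S.push_add, push_id, S.push_neg, push_comp _ g, hh, add_neg_cancel]

/-- The extension realized by the left `A`-determined inflation attached to the radical of `End A`
has an almost split component. -/
theorem HasLeftDeterminedInflations.exists_isAlmostSplit [HasFiniteBiproducts C]
    {S : NExangulatedStructure.{w, w'} k C n} (hL : S.HasLeftDeterminedInflations) (hn : 1 ≤ n)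
    (hKS : IsKrullSchmidt C) (A : C) [IsLocalRing (End A)] :
    ∃ (X : C) (δ : Ext S.E X A), IsAlmostSplit δ := by
  have := HasBinaryBiproducts.of_hasBinaryProducts (C := C)
  obtain ⟨B, α, hα, hdet, hH⟩ := (hL A).exists_inflation A (radicalPostcomp A)
  obtain ⟨X', δ', hδ'⟩ := hα.exists_ext
  have hmem : ∀ f : A ⟶ A, (∃ t, α ≫ t = f) ↔ ¬ IsIso f := fun f =>
    (Set.ext_iff.1 hH f :)
  have hann : ∀ (L : C) (g : A ⟶ L), (∀ h : L ⟶ A, ¬ IsIso (g ≫ h)) → push S.E g δ' = 0 :=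
    fun L g hg => (hδ' L g).1 (hdet L g fun h => (hmem _).2 (hg h))
  have hne : δ' ≠ 0 := fun h0 => (hmem (𝟙 A)).1 ((hδ' A _).2 (by rw [h0, map_zero])) inferInstance
  obtain ⟨m, Y, ι, π, hY, hsum⟩ := hKS.exists_isDirectSum X'
  obtain ⟨j, hj⟩ := S.exists_pull_ne_zero hsum hne
  have := hY j
  have hpull : ∀ (Z : C) (η : Ext S.E Z A), η ≠ 0 →
      ∃ h : Y j ⟶ Z, pull S.E h η = pull S.E (ι j) δ' := by
    intro Z η hη
    refine S.exists_pull_eq hn η _ fun W g hg => ?_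
    rw [push_pull, hann W g fun h hi => hη ?_, map_zero]
    exact S.eq_zero_of_push_eq_zero (g ≫ h) (by rw [push_comp, hg, map_zero])
  refine ⟨Y j, pull S.E (ι j) δ', hj, fun Z η hη => S.exists_push_eq hn η _ ?_, hpull⟩
  intro W g hg
  by_contra h0
  obtain ⟨h, hh⟩ := hpull W _ h0
  rcases isIso_or_isIso_of_add_eq_id (add_sub_cancel (h ≫ g) (𝟙 (Y j))) with hi | hi
  · exact hη (S.eq_zero_of_pull_eq_zero (h ≫ g) (by rw [pull_comp, hg, map_zero]))
  · refine hj (S.eq_zero_of_pull_eq_zero (𝟙 _ - h ≫ g) ?_)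
    rw [sub_eq_add_neg, S.pull_add, pull_id, S.pull_neg, pull_comp _ h, hh, add_neg_cancel]

/-- The deflation attached to the zero submodule embeds `C(D, Y)` into an extension module. -/
theorem HasRightDeterminedDeflations.exists_pull_injective
    {S : NExangulatedStructure.{w, w'} k C n} (hR : S.HasRightDeterminedDeflations) (D Y : C) :
    ∃ (A : C) (δ : Ext S.E Y A), ∀ f : D ⟶ Y, pull S.E f δ = 0 → f = 0 := by
  obtain ⟨B, α, hα, -, hH⟩ := (hR Y).exists_deflation D ⊥
  obtain ⟨A, δ, hδ⟩ := hα.exists_ext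
  exact ⟨A, δ, fun f hf => (Set.ext_iff.1 hH f).1 ((hδ D f).2 hf)⟩

/-- The inflation attached to the zero submodule embeds `C(X, D)` into an extension module. -/
theorem HasLeftDeterminedInflations.exists_push_injective
    {S : NExangulatedStructure.{w, w'} k C n} (hL : S.HasLeftDeterminedInflations) (X D : C) :
    ∃ (Z : C) (δ : Ext S.E Z X), ∀ f : X ⟶ D, push S.E f δ = 0 → f = 0 := by
  obtain ⟨B, α, hα, -, hH⟩ := (hL X).exists_inflation D ⊥
  obtain ⟨Z, δ, hδ⟩ := hα.exists_ext
  exact ⟨Z, δ, fun f hf => (Set.ext_iff.1 hH f).1 ((hδ D f).2 hf)⟩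

end NExangulatedStructure

namespace NExangulatedStructure

variable {k : Type w} [CommRing k] {C : Type u} [Category.{v} C] [Preadditive C] [Linear k C]
  {n : ℕ} {S : NExangulatedStructure.{w, w'} k C n}

/-! ### Perfect forms -/

/-- The map `C(Z, A) → D𝔼(X, Z)`, `f ↦ ξ ∘ f_*`, which corresponds to a form `ξ` on `𝔼(X, A)` by the
Yoneda lemma. -/
noncomputable def pushForm {X A : C} (ξ : MatlisDual k (Ext S.E X A)) (Z : C) :
    (Z ⟶ A) →ₗ[k] MatlisDual k (Ext S.E X Z) where
  toFun f := ξ ∘ₗ push S.E f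
  map_add' f g := LinearMap.ext fun η =>
    (congrArg ξ (S.push_add f g η)).trans (map_add ξ (push S.E f η) (push S.E g η))
  map_smul' r f := LinearMap.ext fun η =>
    (congrArg ξ (S.push_smul r f η)).trans (map_smul ξ r (push S.E f η))

/-- The map `C(X, Z) → D𝔼(Z, A)`, `f ↦ ξ ∘ f^*`, which corresponds to a form `ξ` on `𝔼(X, A)` by the
Yoneda lemma. -/
noncomputable def pullForm {X A : C} (ξ : MatlisDual k (Ext S.E X A)) (Z : C) :
    (X ⟶ Z) →ₗ[k] MatlisDual k (Ext S.E Z A) where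
  toFun f := ξ ∘ₗ pull S.E f
  map_add' f g := LinearMap.ext fun η =>
    (congrArg ξ (S.pull_add f g η)).trans (map_add ξ (pull S.E f η) (pull S.E g η))
  map_smul' r f := LinearMap.ext fun η =>
    (congrArg ξ (S.pull_smul r f η)).trans (map_smul ξ r (pull S.E f η))

@[simp]
theorem pushForm_apply {X A Z : C} (ξ : MatlisDual k (Ext S.E X A)) (f : Z ⟶ A)
    (η : Ext S.E X Z) : pushForm ξ Z f η = ξ (push S.E f η) := rfl

@[simp]
theorem pullForm_apply {X A Z : C} (ξ : MatlisDual k (Ext S.E X A)) (f : X ⟶ Z)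
    (η : Ext S.E Z A) : pullForm ξ Z f η = ξ (pull S.E f η) := rfl

/-- The form `ξ` on `𝔼(X, A)` is perfect: it represents `D𝔼(X, -)` by `A` and corepresents
`D𝔼(-, A)` by `X`. -/
structure IsPerfect {X A : C} (ξ : MatlisDual k (Ext S.E X A)) : Prop where
  bijective_pushForm : ∀ Z, Function.Bijective (pushForm ξ Z)
  bijective_pullForm : ∀ Z, Function.Bijective (pullForm ξ Z)

/-- A form which does not vanish on an almost split extension is perfect. -/
theorem IsAlmostSplit.exists_isPerfect [IsArtinianRing k] (hfin : S.IsExtFinite)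
    (hR : S.HasRightDeterminedDeflations) (hL : S.HasLeftDeterminedInflations) {X A : C}
    {δ : Ext S.E X A} (h : IsAlmostSplit δ) :
    ∃ ξ : MatlisDual k (Ext S.E X A), IsPerfect ξ := by
  obtain ⟨ξ, hξ⟩ := exists_matlisDual_ne_zero (k := k) h.ne_zero
  refine ⟨ξ, fun Z => ⟨(injective_iff_map_eq_zero _).2 fun f hf => ?_, fun ζ => ?_⟩,
    fun Z => ⟨(injective_iff_map_eq_zero _).2 fun f hf => ?_, fun ζ => ?_⟩⟩
  · obtain ⟨B, θ, hθ⟩ := hL.exists_push_injective Z A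
    by_contra hne
    obtain ⟨c, hc⟩ := h.exists_pull _ _ (mt (hθ f) hne)
    refine hξ ?_
    rw [← hc, ← push_pull, ← pushForm_apply, hf, LinearMap.zero_apply]
  · by_contra hζ
    have := hfin X Z
    obtain ⟨η, h0, hη⟩ := exists_forall_mem_eq_zero_and_ne_zero (LinearMap.range (pushForm ξ Z))
      (ξ := ζ) hζ
    obtain ⟨a, ha⟩ := h.exists_push Z η fun h => hη (by rw [h, map_zero])
    exact hξ (by rw [← ha, ← pushForm_apply, h0 _ ⟨a, rfl⟩])
  · obtain ⟨B, θ, hθ⟩ := hR.exists_pull_injective X Z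
    by_contra hne
    obtain ⟨a, ha⟩ := h.exists_push _ _ (mt (hθ f) hne)
    refine hξ ?_
    rw [← ha, push_pull, ← pullForm_apply, hf, LinearMap.zero_apply]
  · by_contra hζ
    have := hfin Z A
    obtain ⟨η, h0, hη⟩ := exists_forall_mem_eq_zero_and_ne_zero (LinearMap.range (pullForm ξ Z))
      (ξ := ζ) hζ
    obtain ⟨c, hc⟩ := h.exists_pull Z η fun h => hη (by rw [h, map_zero])
    exact hξ (by rw [← hc, ← pullForm_apply, h0 _ ⟨c, rfl⟩])

/-- Direct sums of perfect forms are perfect. -/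
theorem IsPerfect.directSum {m : ℕ} {X A : C} {Y B : Fin m → C} {ι : ∀ j, Y j ⟶ X}
    {π : ∀ j, X ⟶ Y j} {ι' : ∀ j, B j ⟶ A} {π' : ∀ j, A ⟶ B j} (hX : IsDirectSum ι π)
    (hA : IsDirectSum ι' π') {ξ : ∀ j, MatlisDual k (Ext S.E (Y j) (B j))}
    (hξ : ∀ j, IsPerfect (ξ j)) :
    IsPerfect (∑ j, ξ j ∘ₗ push S.E (π' j) ∘ₗ pull S.E (ι j) : MatlisDual k (Ext S.E X A)) := by
  have hsum : ∀ η : Ext S.E X A, (∑ j, ξ j ∘ₗ push S.E (π' j) ∘ₗ pull S.E (ι j)) η =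
      ∑ j, ξ j (push S.E (π' j) (pull S.E (ι j) η)) := fun η => by
    rw [LinearMap.sum_apply]
    rfl
  refine ⟨fun Z => ⟨(injective_iff_map_eq_zero _).2 fun f hf => ?_, fun ζ => ?_⟩,
    fun Z => ⟨(injective_iff_map_eq_zero _).2 fun f hf => ?_, fun ζ => ?_⟩⟩
  · have h0 : ∀ j, f ≫ π' j = 0 := by
      intro j
      refine (injective_iff_map_eq_zero _).1 ((hξ j).bijective_pushForm Z).1 _
        (LinearMap.ext fun η => ?_)
      have := DFunLike.congr_fun hf (pull S.E (π j) η)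
      rw [pushForm_apply, hsum, Finset.sum_eq_single j] at this
      · rwa [← push_pull S.E f (ι j), ← pull_comp, hX.ι_π_self, pull_id, ← push_comp] at this
      · intro i _ hij
        rw [← push_pull S.E f (ι i), ← pull_comp, hX.ι_π_of_ne i j hij, pull_zero, map_zero, map_zero,
          map_zero]
      · simp
    rw [← Category.comp_id f, ← hA.total, Preadditive.comp_sum]
    exact Finset.sum_eq_zero fun j _ => by rw [← Category.assoc, h0, zero_comp]
  · choose f hf using fun j => ((hξ j).bijective_pushForm Z).2 (ζ ∘ₗ pull S.E (π j))
    refine ⟨∑ j, f j ≫ ι' j, LinearMap.ext fun η => ?_⟩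
    have hfπ : ∀ j, (∑ i, f i ≫ ι' i) ≫ π' j = f j := by
      intro j
      rw [Preadditive.sum_comp, Finset.sum_eq_single j]
      · rw [Category.assoc, hA.ι_π_self, Category.comp_id]
      · intro i _ hij
        rw [Category.assoc, hA.ι_π_of_ne i j hij, comp_zero]
      · simp
    rw [pushForm_apply, hsum]
    conv_rhs => rw [← pull_id S.E η, ← hX.total, pull_sum, map_sum]
    refine Finset.sum_congr rfl fun j _ => ?_
    rw [← push_pull, ← push_comp, hfπ, ← pushForm_apply, hf, pull_comp]
    rfl
  · have h0 : ∀ j, ι j ≫ f = 0 := by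
      intro j
      refine (injective_iff_map_eq_zero _).1 ((hξ j).bijective_pullForm Z).1 _
        (LinearMap.ext fun η => ?_)
      have := DFunLike.congr_fun hf (push S.E (ι' j) η)
      rw [pullForm_apply, hsum, Finset.sum_eq_single j] at this
      · rwa [push_pull, push_pull, ← push_comp, hA.ι_π_self, push_id, ← pull_comp] at this
      · intro i _ hij
        rw [push_pull, push_pull, ← push_comp, hA.ι_π_of_ne j i hij.symm, push_zero, map_zero,
          map_zero, map_zero]
      · simp
    rw [← Category.id_comp f, ← hX.total, Preadditive.sum_comp]
    exact Finset.sum_eq_zero fun j _ => by rw [Category.assoc, h0, comp_zero]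
  · choose f hf using fun j => ((hξ j).bijective_pullForm Z).2 (ζ ∘ₗ push S.E (ι' j))
    refine ⟨∑ j, π j ≫ f j, LinearMap.ext fun η => ?_⟩
    have hfι : ∀ j, ι j ≫ (∑ i, π i ≫ f i) = f j := by
      intro j
      rw [Preadditive.comp_sum, Finset.sum_eq_single j]
      · rw [← Category.assoc, hX.ι_π_self, Category.id_comp]
      · intro i _ hij
        rw [← Category.assoc, hX.ι_π_of_ne j i hij.symm, zero_comp]
      · simp
    rw [pullForm_apply, hsum]
    conv_rhs => rw [← push_id S.E η, ← hA.total, push_sum, map_sum]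
    refine Finset.sum_congr rfl fun j _ => ?_
    rw [← pull_comp, hfι, push_pull, ← pullForm_apply, hf, push_comp]
    rfl

/-! ### Perfect forms from determined morphisms -/

theorem exists_isPerfect_left [IsArtinianRing k] [HasFiniteBiproducts C] (hn : 1 ≤ n)
    (hKS : IsKrullSchmidt C) (hfin : S.IsExtFinite) (hR : S.HasRightDeterminedDeflations)
    (hL : S.HasLeftDeterminedInflations) (X : C) :
    ∃ (A : C) (ξ : MatlisDual k (Ext S.E X A)), IsPerfect ξ := by
  obtain ⟨m, Y, ι, π, hY, hX⟩ := hKS.exists_isDirectSum X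
  choose B δ hδ using fun j => hR.exists_isAlmostSplit hn hKS (Y j)
  choose ξ hξ using fun j => (hδ j).exists_isPerfect hfin hR hL
  exact ⟨⨁ B, _, .directSum hX (.biproduct B) hξ⟩

theorem exists_isPerfect_right [IsArtinianRing k] [HasFiniteBiproducts C] (hn : 1 ≤ n)
    (hKS : IsKrullSchmidt C) (hfin : S.IsExtFinite) (hR : S.HasRightDeterminedDeflations)
    (hL : S.HasLeftDeterminedInflations) (A : C) :
    ∃ (X : C) (ξ : MatlisDual k (Ext S.E X A)), IsPerfect ξ := by
  obtain ⟨m, B, ι, π, hB, hA⟩ := hKS.exists_isDirectSum A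
  choose Y δ hδ using fun j => hL.exists_isAlmostSplit hn hKS (B j)
  choose ξ hξ using fun j => (hδ j).exists_isPerfect hfin hR hL
  exact ⟨⨁ Y, _, .directSum (.biproduct Y) hA hξ⟩

/-! ### Determined morphisms from perfect forms -/

/-- If `𝔼(X, A)` carries a perfect form, then `X` detects the vanishing of extensions by `A`. -/
theorem IsPerfect.eq_zero_of_pull [IsArtinianRing k] {X A : C} {ξ : MatlisDual k (Ext S.E X A)}
    (hξ : IsPerfect ξ) {L : C} {η : Ext S.E L A} (h : ∀ f : X ⟶ L, pull S.E f η = 0) : η = 0 := by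
  by_contra hη
  obtain ⟨ζ, hζ⟩ := exists_matlisDual_ne_zero (k := k) hη
  obtain ⟨f, rfl⟩ := (hξ.bijective_pullForm L).2 ζ
  exact hζ (by rw [pullForm_apply, h, map_zero])

/-- If `𝔼(X, A)` carries a perfect form, then `A` detects the vanishing of extensions of `X`. -/
theorem IsPerfect.eq_zero_of_push [IsArtinianRing k] {X A : C} {ξ : MatlisDual k (Ext S.E X A)}
    (hξ : IsPerfect ξ) {L : C} {η : Ext S.E X L} (h : ∀ f : L ⟶ A, push S.E f η = 0) : η = 0 := by
  by_contra hη
  obtain ⟨ζ, hζ⟩ := exists_matlisDual_ne_zero (k := k) hη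
  obtain ⟨f, rfl⟩ := (hξ.bijective_pushForm L).2 ζ
  exact hζ (by rw [pushForm_apply, h, map_zero])

/-- For a perfect form on `𝔼(D, A)`, a submodule `H` of `C(D, Y) ≅ D𝔼(Y, A)` is the annihilator of
its own annihilator in `𝔼(Y, A)`. The generators of the latter are the components of an extension
of `Y` by a power of `A` whose deflation is as required. -/
theorem hasRightDeterminedDeflations_of_isPerfect [IsArtinianRing k] [HasFiniteBiproducts C]
    (hfin : S.IsExtFinite)
    (hl : ∀ X : C, ∃ (A : C) (ξ : MatlisDual k (Ext S.E X A)), IsPerfect ξ)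
    (hr : ∀ A : C, ∃ (X : C) (ξ : MatlisDual k (Ext S.E X A)), IsPerfect ξ) :
    S.HasRightDeterminedDeflations := by
  refine fun Y => ⟨fun X α hα => ?_, fun D H => ?_⟩
  · obtain ⟨A, δ, hδ⟩ := hα.exists_ext
    obtain ⟨D, ξ, hξ⟩ := hr A
    exact ⟨D, fun L g hg => (hδ L g).2 (hξ.eq_zero_of_pull fun f => by
      rw [← pull_comp, (hδ D _).1 (hg f)])⟩
  · obtain ⟨A, ξ, hξ⟩ := hl D
    have := hfin Y A
    have hcomp : ∀ (r : D ⟶ D) (f : D ⟶ Y), f ∈ H → r ≫ f ∈ H := fun r f hf =>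
      H.smul_mem (MulOpposite.op r) hf
    let H' : Submodule k (D ⟶ Y) :=
      { carrier := H
        zero_mem' := H.zero_mem
        add_mem' := H.add_mem
        smul_mem' := fun r f hf => by
          have := hcomp (r • 𝟙 D) f hf
          rwa [Linear.smul_comp, Category.id_comp] at this }
    let P : Submodule k (Ext S.E Y A) := ⨅ f ∈ H, LinearMap.ker (pull S.E f)
    have hP : ∀ η, η ∈ P ↔ ∀ f ∈ H, pull S.E f η = 0 := fun η => by
      simp [P, Submodule.mem_iInf]
    have hH : ∀ f : D ⟶ Y, (∀ η ∈ P, pull S.E f η = 0) → f ∈ H := by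
      intro f hf
      by_contra hfH
      obtain ⟨η, hη, hfη⟩ := exists_forall_mem_eq_zero_and_ne_zero (H'.map (pullForm ξ Y))
        (ξ := pullForm ξ Y f) (by
          rintro ⟨g, hg, hgf⟩
          obtain rfl := (hξ.bijective_pullForm Y).1 hgf
          exact hfH hg)
      refine hfη ?_
      rw [pullForm_apply, hf η ((hP η).2 fun g hg => ?_), map_zero]
      -- `H` is stable under endomorphisms of `D`, so `ξ` may be replaced by all forms
      by_contra h0
      obtain ⟨ζ, hζ⟩ := exists_matlisDual_ne_zero (k := k) h0
      obtain ⟨r, rfl⟩ := (hξ.bijective_pullForm D).2 ζ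
      exact hζ (by
        rw [pullForm_apply, ← pull_comp, ← pullForm_apply]
        exact hη _ ⟨_, hcomp r g hg, rfl⟩)
    obtain ⟨m, s, hs⟩ := Submodule.fg_iff_exists_fin_generating_family.1 (IsNoetherian.noetherian P)
    let δ : Ext S.E Y (⨁ fun _ : Fin m => A) :=
      ∑ i, push S.E (biproduct.ι (fun _ : Fin m => A) i) (s i)
    have hπ : ∀ j, push S.E (biproduct.π (fun _ : Fin m => A) j) δ = s j := by
      intro j
      rw [map_sum, Finset.sum_eq_single j]
      · rw [← push_comp, biproduct.ι_π_self, push_id]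
      · intro i _ hij
        rw [← push_comp, biproduct.ι_π_ne _ hij, push_zero]
      · simp
    have hδ : ∀ (L : C) (g : L ⟶ Y), pull S.E g δ = 0 ↔ ∀ j, pull S.E g (s j) = 0 := by
      intro L g
      refine ⟨fun h j => by rw [← hπ, ← push_pull, h, map_zero], fun h => ?_⟩
      rw [map_sum]
      exact Finset.sum_eq_zero fun j _ => by rw [← push_pull, h, map_zero]
    obtain ⟨X, α, hα, hfac⟩ := S.exists_isDeflation δ
    refine ⟨X, α, hα, fun L g hg => ?_, Set.ext fun f => ?_⟩
    · refine (hfac L g).2 ((hδ L g).2 fun j => hξ.eq_zero_of_pull fun f => ?_)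
      rw [← pull_comp]
      exact (hδ D _).1 ((hfac D _).1 (hg f)) j
    · refine (hfac D f).trans ((hδ D f).trans ⟨fun h => hH f fun η hη => ?_, fun hf j => ?_⟩)
      · have hle : Submodule.span k (Set.range s) ≤ LinearMap.ker (pull S.E f) :=
          Submodule.span_le.2 (Set.range_subset_iff.2 h)
        exact hle (hs ▸ hη)
      · exact (hP _).1 (hs ▸ Submodule.subset_span ⟨j, rfl⟩) f hf

/-- The dual of `hasRightDeterminedDeflations_of_isPerfect`. -/
theorem hasLeftDeterminedInflations_of_isPerfect [IsArtinianRing k] [HasFiniteBiproducts C]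
    (hfin : S.IsExtFinite)
    (hl : ∀ X : C, ∃ (A : C) (ξ : MatlisDual k (Ext S.E X A)), IsPerfect ξ)
    (hr : ∀ A : C, ∃ (X : C) (ξ : MatlisDual k (Ext S.E X A)), IsPerfect ξ) :
    S.HasLeftDeterminedInflations := by
  refine fun X => ⟨fun Y α hα => ?_, fun D H => ?_⟩
  · obtain ⟨Z, δ, hδ⟩ := hα.exists_ext
    obtain ⟨D, ξ, hξ⟩ := hl Z
    exact ⟨D, fun L g hg => (hδ L g).2 (hξ.eq_zero_of_push fun f => by
      rw [← push_comp, (hδ D _).1 (hg f)])⟩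
  · obtain ⟨Z, ξ, hξ⟩ := hr D
    have := hfin Z X
    have hcomp : ∀ (r : D ⟶ D) (f : X ⟶ D), f ∈ H → f ≫ r ∈ H := fun r f hf =>
      H.smul_mem (show End D from r) hf
    let H' : Submodule k (X ⟶ D) :=
      { carrier := H
        zero_mem' := H.zero_mem
        add_mem' := H.add_mem
        smul_mem' := fun r f hf => by
          have := hcomp (r • 𝟙 D) f hf
          rwa [Linear.comp_smul, Category.comp_id] at this }
    let P : Submodule k (Ext S.E Z X) := ⨅ f ∈ H, LinearMap.ker (push S.E f)
    have hP : ∀ η, η ∈ P ↔ ∀ f ∈ H, push S.E f η = 0 := fun η => by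
      simp [P, Submodule.mem_iInf]
    have hH : ∀ f : X ⟶ D, (∀ η ∈ P, push S.E f η = 0) → f ∈ H := by
      intro f hf
      by_contra hfH
      obtain ⟨η, hη, hfη⟩ := exists_forall_mem_eq_zero_and_ne_zero (H'.map (pushForm ξ X))
        (ξ := pushForm ξ X f) (by
          rintro ⟨g, hg, hgf⟩
          obtain rfl := (hξ.bijective_pushForm X).1 hgf
          exact hfH hg)
      refine hfη ?_
      rw [pushForm_apply, hf η ((hP η).2 fun g hg => ?_), map_zero]
      by_contra h0
      obtain ⟨ζ, hζ⟩ := exists_matlisDual_ne_zero (k := k) h0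
      obtain ⟨r, rfl⟩ := (hξ.bijective_pushForm D).2 ζ
      exact hζ (by
        rw [pushForm_apply, ← push_comp, ← pushForm_apply]
        exact hη _ ⟨_, hcomp r g hg, rfl⟩)
    obtain ⟨m, s, hs⟩ := Submodule.fg_iff_exists_fin_generating_family.1 (IsNoetherian.noetherian P)
    let δ : Ext S.E (⨁ fun _ : Fin m => Z) X :=
      ∑ i, pull S.E (biproduct.π (fun _ : Fin m => Z) i) (s i)
    have hι : ∀ j, pull S.E (biproduct.ι (fun _ : Fin m => Z) j) δ = s j := by
      intro j
      rw [map_sum, Finset.sum_eq_single j]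
      · rw [← pull_comp, biproduct.ι_π_self, pull_id]
      · intro i _ hij
        rw [← pull_comp, biproduct.ι_π_ne _ hij.symm, pull_zero]
      · simp
    have hδ : ∀ (L : C) (g : X ⟶ L), push S.E g δ = 0 ↔ ∀ j, push S.E g (s j) = 0 := by
      intro L g
      refine ⟨fun h j => by rw [← hι, push_pull, h, map_zero], fun h => ?_⟩
      rw [map_sum]
      exact Finset.sum_eq_zero fun j _ => by rw [push_pull, h, map_zero]
    obtain ⟨Y, α, hα, hfac⟩ := S.exists_isInflation δ
    refine ⟨Y, α, hα, fun L g hg => ?_, Set.ext fun f => ?_⟩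
    · refine (hfac L g).2 ((hδ L g).2 fun j => hξ.eq_zero_of_push fun f => ?_)
      rw [← push_comp]
      exact (hδ D _).1 ((hfac D _).1 (hg f)) j
    · refine (hfac D f).trans ((hδ D f).trans ⟨fun h => hH f fun η hη => ?_, fun hf j => ?_⟩)
      · have hle : Submodule.span k (Set.range s) ≤ LinearMap.ker (push S.E f) :=
          Submodule.span_le.2 (Set.range_subset_iff.2 h)
        exact hle (hs ▸ hη)
      · exact (hP _).1 (hs ▸ Submodule.subset_span ⟨j, rfl⟩) f hf

/-! ### Perfect forms and Serre duality -/

/-- Under Serre duality, the form on `𝔼(X, A)` corresponding to an isomorphism `A ≅ τ X` is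
perfect. -/
theorem HasSerreDuality.exists_isPerfect (h : S.HasSerreDuality) :
    (∀ X : C, ∃ (A : C) (ξ : MatlisDual k (Ext S.E X A)), IsPerfect ξ) ∧
      ∀ A : C, ∃ (X : C) (ξ : MatlisDual k (Ext S.E X A)), IsPerfect ξ := by
  obtain ⟨τ, φ, -, -, hφ₁, hφ₂⟩ := h
  have key : ∀ (X A : C) (e : A ≅ τ.functor.obj X), IsPerfect ((φ X A).symm e.hom) := by
    refine fun X A e => ⟨fun Z => ?_, fun Z => ?_⟩
    · have h1 : ∀ f, φ X Z (pushForm ((φ X A).symm e.hom) Z f) = f ≫ e.hom := fun f => by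
        rw [← (φ X A).apply_symm_apply e.hom, ← hφ₁, (φ X A).symm_apply_apply]
        rfl
      refine (Function.Bijective.of_comp_iff' (φ X Z).bijective _).1 ?_
      rw [show (φ X Z) ∘ (pushForm ((φ X A).symm e.hom) Z) = fun f => f ≫ e.hom from funext h1]
      exact e.homToEquiv.bijective
    · have h1 : ∀ f, φ Z A (pullForm ((φ X A).symm e.hom) Z f) = e.hom ≫ τ.functor.map f :=
        fun f => by
          rw [← (φ X A).apply_symm_apply e.hom, ← hφ₂, (φ X A).symm_apply_apply]
          rfl
      refine (Function.Bijective.of_comp_iff' (φ Z A).bijective _).1 ?_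
      rw [show (φ Z A) ∘ (pullForm ((φ X A).symm e.hom) Z) = fun f => e.hom ≫ τ.functor.map f from
        funext h1]
      exact e.homFromEquiv.symm.bijective.comp (τ.fullyFaithfulFunctor.map_bijective _ _)
  exact ⟨fun X => ⟨_, _, key X _ (Iso.refl _)⟩, fun A => ⟨_, _, key _ A (τ.counitIso.app A).symm⟩⟩

/-- Choosing a perfect form `ξ X` on `𝔼(X, τ X)` for each `X` makes `τ` a functor: the morphism
`τ a` is the one with `ξ X' ∘ (τ a)_* = ξ X ∘ a^*`. It is fully faithful because both sides
represent all forms on `𝔼(X', τ X)`. -/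
theorem hasSerreDuality_of_isPerfect
    (hl : ∀ X : C, ∃ (A : C) (ξ : MatlisDual k (Ext S.E X A)), IsPerfect ξ)
    (hr : ∀ A : C, ∃ (X : C) (ξ : MatlisDual k (Ext S.E X A)), IsPerfect ξ) :
    S.HasSerreDuality := by
  choose T ξ hξ using hl
  let e : ∀ X Z : C, (Z ⟶ T X) ≃ₗ[k] MatlisDual k (Ext S.E X Z) := fun X Z =>
    LinearEquiv.ofBijective (pushForm (ξ X) Z) ((hξ X).bijective_pushForm Z)
  have he : ∀ (X Z : C) (f : Z ⟶ T X) (η : Ext S.E X Z), e X Z f η = ξ X (push S.E f η) :=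
    fun _ _ _ _ => rfl
  let t : ∀ X X' : C, (X ⟶ X') →ₗ[k] (T X ⟶ T X') := fun X X' =>
    (e X' (T X)).symm.toLinearMap ∘ₗ pullForm (ξ X) X'
  have ht : ∀ {X X' : C} (a : X ⟶ X') (η : Ext S.E X' (T X)),
      ξ X' (push S.E (t X X' a) η) = ξ X (pull S.E a η) := fun {X X'} a η => by
    rw [← he]
    exact DFunLike.congr_fun ((e X' (T X)).apply_symm_apply _) η
  let F : C ⥤ C :=
    { obj := T
      map := fun {X X'} a => t X X' a
      map_id := fun X => (e X (T X)).injective (LinearMap.ext fun η => by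
        rw [he, he, ht, pull_id, push_id])
      map_comp := fun {X X' X''} a b => (e X'' (T X)).injective (LinearMap.ext fun η => by
        rw [he, he, ht, push_comp, ht, ← push_pull, ht, pull_comp]) }
  have hF : ∀ X X' : C, Function.Bijective (t X X') := fun X X' =>
    (e X' (T X)).symm.bijective.comp ((hξ X).bijective_pullForm X')
  have : F.Full := ⟨fun {X X'} => (hF X X').2⟩
  have : F.Faithful := ⟨fun {X X'} _ _ h => (hF X X').1 h⟩
  have : F.EssSurj := by
    refine ⟨fun A => ?_⟩
    obtain ⟨X, ζ, hζ⟩ := hr A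
    -- two representations of `D𝔼(X, -)` are isomorphic
    obtain ⟨f, hf⟩ := ((hξ X).bijective_pushForm A).2 ζ
    obtain ⟨g, hg⟩ := (hζ.bijective_pushForm (T X)).2 (ξ X)
    refine ⟨X, ⟨⟨g, f, ?_, ?_⟩⟩⟩
    · refine ((hξ X).bijective_pushForm (T X)).1 (LinearMap.ext fun η => ?_)
      rw [pushForm_apply, push_comp, ← pushForm_apply (ξ X), hf, ← pushForm_apply, hg,
        pushForm_apply, push_id]
    · refine (hζ.bijective_pushForm A).1 (LinearMap.ext fun η => ?_)
      rw [pushForm_apply, push_comp, ← pushForm_apply ζ, hg, ← pushForm_apply, hf,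
        pushForm_apply, push_id]
  have : F.IsEquivalence := { }
  have hnat₁ : ∀ (X Y Y' : C) (b : Y' ⟶ Y) (ζ : MatlisDual k (Ext S.E X Y)),
      (e X Y').symm (ζ ∘ₗ push S.E b) = b ≫ (e X Y).symm ζ := by
    intro X Y Y' b ζ
    obtain ⟨f, rfl⟩ := (e X Y).surjective ζ
    rw [LinearEquiv.symm_apply_eq, LinearEquiv.symm_apply_apply]
    refine LinearMap.ext fun η => ?_
    rw [he, push_comp, LinearMap.comp_apply, he]
  have hnat₂ : ∀ (X X' Y : C) (a : X ⟶ X') (ζ : MatlisDual k (Ext S.E X Y)),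
      (e X' Y).symm (ζ ∘ₗ pull S.E a) = (e X Y).symm ζ ≫ t X X' a := by
    intro X X' Y a ζ
    obtain ⟨f, rfl⟩ := (e X Y).surjective ζ
    rw [LinearEquiv.symm_apply_eq, LinearEquiv.symm_apply_apply]
    refine LinearMap.ext fun η => ?_
    rw [he, push_comp, ht, LinearMap.comp_apply, he, push_pull]
  exact ⟨F.asEquivalence, fun X Y => (e X Y).symm, ⟨fun {X X' a b} => map_add (t X X') a b⟩,
    ⟨fun {X X'} a r => map_smul (t X X') r a⟩, hnat₁, hnat₂⟩

end NExangulatedStructure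

theorem theorem3p15 {k : Type w} [CommRing k] [IsArtinianRing k]
    {C : Type u} [Category.{v} C] [Preadditive C] [HasFiniteBiproducts C] [Linear k C]
    (n : ℕ) (hn : 1 ≤ n) (S : NExangulatedStructure.{w, w'} k C n)
    (hKS : IsKrullSchmidt C) (hfin : S.IsExtFinite) :
    S.HasSerreDuality ↔ S.HasRightDeterminedDeflations ∧ S.HasLeftDeterminedInflations := by
  refine ⟨fun h => ?_, fun ⟨hR, hL⟩ => ?_⟩
  · obtain ⟨hl, hr⟩ := h.exists_isPerfect
    exact ⟨NExangulatedStructure.hasRightDeterminedDeflations_of_isPerfect hfin hl hr,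
      NExangulatedStructure.hasLeftDeterminedInflations_of_isPerfect hfin hl hr⟩
  · exact NExangulatedStructure.hasSerreDuality_of_isPerfect
      (NExangulatedStructure.exists_isPerfect_left hn hKS hfin hR hL)
      (NExangulatedStructure.exists_isPerfect_right hn hKS hfin hR hL)
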